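/- Conventions. For an ordinal $\eta$ let $[0,\eta]$ carry the order topology, let $C([0,\eta])$ be the Banach space of real- or complex-valued continuous functions on it with the supremum norm, and identify its dual with the space of Radon measures on $[0,\eta]$ (each of which is countably supported, so that this space is $\ell^1([0,\eta])$). Let $I(\eta)$ be the set of isolated ordinals (zero and successors) in $[0,\eta]$ and let $$D=D(\eta)=\{\mu : \mu(\{x\})=0 \text{ for each } x\in[0,\eta] \text{ of uncountable cofinality}\}.$$ Let $\sigma(C,D)$ be the weakest topology on $C([0,\eta])$ making all $\mu\in D$ continuous. A Markushevich basis $(x_i,x_i^*)_{i\in\Lambda}$ of a Banach space $X$ is a biorthogonal family in $X\times X^*$ such that the $x_i$ are linearly dense and the $x_i^*$ separate the points of $X$; it is strong if each $x\in X$ lies in the closed linear span of $\{x_i: x_i^*(x)\neq 0\}$. A projectional resolution of the identity (PRI) on $X$, where $\kappa=\operatorname{dens}X$, is a family of projections $(P_\alpha)_{\alpha\le\kappa}$ with $P_0=0$, $P_\kappa=I$; $\|P_\alpha\|=1$ for $0<\alpha\le\kappa$; $\operatorname{dens}P_\alpha X\le\max\{\aleph_0,\operatorname{card}\alpha\}$;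 $P_\alpha P_\beta=P_\beta P_\alpha=P_\alpha$ for $\alpha\le\beta\le\kappa$; $P_\lambda X=\overline{\bigcup_{\alpha<\lambda}P_\alpha X}$ for limit $\lambda\le\kappa$. A projectional skeleton on $X$ is a family $(Q_s)_{s\in\Gamma}$ of bounded projections indexed by an up-directed partially ordered set such that each $Q_sX$ is separable, $Q_sQ_t=Q_tQ_s=Q_s$ for $s\le t$, every increasing sequence $(s_n)$ in $\Gamma$ has a supremum $s$ and $Q_sX=\overline{\bigcup_nQ_{s_n}X}$, and $X=\bigcup_sQ_sX$; it is commutative if $Q_sQ_t=Q_tQ_s$ for all $s,t$, and it induces the subspace $\bigcup_sQ_s^*X^*$ of $X^*$. A topological space is primarily Lindelöf if it is a continuous image of a closed subset of $(L_\Gamma)^{\mathbb N}$ for some set $\Gamma$, where $L_\Gamma$ is the one-point lindelöfication of the discrete set $\Gamma$. A subspace of $X^*$ is weak$^*$-countably closed if it contains the weak$^*$ closures of its countable subsets. Setting. Let $\eta$ be an infinite ordinal, let $\kappa$ be the initial ordinal of cardinality $\operatorname{card}\eta$, and let $\xi:I(\kappa)\to I(\eta)$ be a bijection with $\xi(0)=0$.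 For $\alpha\le\kappa$ put $A_\alpha=\overline{\xi([0,\alpha]\cap I(\kappa))}$ and $r_{A_\alpha}(x)=\max([0,x]\cap A_\alpha)$ for $x\in[0,\eta]$. For $\alpha<\kappa$ and $x\in[0,\eta]\setminus A_\alpha$ put $$z(x,\alpha)=\max\{y\in[x,\eta]:[x,y]\cap A_\alpha=\emptyset\},\qquad p(x,\alpha)=\max(A_\alpha\cap[0,x)).$$ Put $f_0=1$, $\mu_0=\delta_0$, and for $\alpha\in I(\kappa)$, $\alpha\ge1$, $$f_\alpha=\chi_{[\xi(\alpha),\,z(\xi(\alpha),\alpha-1)]},\qquad \mu_\alpha=\delta_{\xi(\alpha)}-\delta_{p(\xi(\alpha),\alpha-1)}.$$ Proposition. All these maxima exist. The formula $P_\alpha f=f\circ r_{A_\alpha}$ ($\alpha\le\kappa$) defines bounded projections on $C([0,\eta])$ with $P_\alpha P_\beta=P_\beta P_\alpha=P_\alpha$ for $\alpha\le\beta\le\kappa$, which form a PRI once $P_0$ is replaced by $0$; moreover $P_0f=\mu_0(f)f_0$ and $(P_\alpha-P_{\alpha-1})f=\mu_\alpha(f)f_\alpha$ for $\alpha\in I(\kappa)$,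 $\alpha\ge1$, and all $f$. Further: (a) $(f_\alpha,\mu_\alpha)_{\alpha\in I(\kappa)}$ is a strong Markushevich basis of $C([0,\eta])$. (b) Let $H=\{f_\alpha:\alpha\in I(\kappa)\}\cup\{0\}$. If $\eta<\omega_2$, then $$D=\{\varphi\in C([0,\eta])^*:\{\alpha\in I(\kappa):\varphi(f_\alpha)\ne0\}\text{ is countable}\};$$ $D$ is weak$^*$-countably closed; $\mu_\alpha\in D$ for all $\alpha\in I(\kappa)$; $H$ is Lindelöf and primarily Lindelöf in $\sigma(C,D)$; $H$ is $\sigma(C,D)$-closed and its nonzero points are $\sigma(C,D)$-isolated in $H$; $D$ is the $\Sigma$-subspace generated by the linearly dense set $M=\{f_\alpha:\alpha\in I(\kappa)\}$, i.e. it consists of those $\varphi$ for which $\{x\in M:\varphi(x)\neq0\}$ is countable; and there is a commutative projectional skeleton $(Q_s)_{s\in\Gamma}$ on $C([0,\eta])$ inducing $D$ such that, for all $s$ and $\alpha$, $Q_sf_\alpha=f_\alpha$ if $f_\alpha\in Q_sC([0,\eta])$ and $Q_sf_\alpha=0$ otherwise. (c) (i) If $\eta$ or $\kappa$ has uncountable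 cofinality, then $0$ is a $\sigma(C,D)$-accumulation point of $H$. (ii) The nonzero $\sigma(C,D)$-accumulation points of $H$ are exactly the functions $\chi_{[a+1,d]}$, where $a<\eta$ has uncountable cofinality, $\theta=\liminf_{x\in[0,a)\cap I(\eta),\,x\to a}\xi^{-1}(x)<\xi^{-1}(a+1)$ and $d=\min\{z(a,\gamma):\gamma<\theta\}$. (iii) The $\sigma(C,D)$-closure of $H$ is the union of $H$ and the set of functions described in (ii). -/

import Mathlib

open Set Filter Topology Cardinal
open scoped Ordinal

/-! ### General notions for a Banach space `X` over `𝕜 = ℝ` or `ℂ` -/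

namespace BanachBasis

universe u v w

section General

variable {𝕜 : Type w} [RCLike 𝕜] {X : Type v} [NormedAddCommGroup X] [NormedSpace 𝕜 X]

/-- The density character of a subset `s` of a topological space: the least cardinality of a
subset of `s` that is dense in `s`. -/
noncomputable def densChar {Y : Type v} [TopologicalSpace Y] (s : Set Y) : Cardinal.{v} :=
  sInf {c | ∃ t : Set Y, t ⊆ s ∧ s ⊆ closure t ∧ #t = c}

/-- `(P_α)_{α ≤ κ}` is a projectional resolution of the identity of `X`, where `κ` is the density
character of `X`, seen as an initial ordinal. The values `P α` for `α > κ` play no role.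
(`mul` on continuous linear operators is composition.) -/
structure IsPRI (κ : Ordinal.{u}) (P : Ordinal.{u} → (X →L[𝕜] X)) : Prop where
  initial : κ.card.ord = κ
  dens_eq : Cardinal.lift.{u} (densChar (Set.univ : Set X)) = Cardinal.lift.{v} κ.card
  zero : P 0 = 0
  last : P κ = 1
  norm_eq : ∀ α, 0 < α → α ≤ κ → ‖P α‖ = 1
  dens_le : ∀ α ≤ κ,
    Cardinal.lift.{u} (densChar (range (P α))) ≤ Cardinal.lift.{v} (max ℵ₀ α.card)
  mul : ∀ α β, α ≤ β → β ≤ κ → P α * P β = P α ∧ P β * P α = P α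
  limit : ∀ l ≤ κ, Order.IsSuccLimit l → range (P l) = closure (⋃ α < l, range (P α))

/-- Markushevich basis. -/
structure IsMarkushevichBasis {Λ : Type u} (x : Λ → X) (x' : Λ → StrongDual 𝕜 X) : Prop where
  apply_self : ∀ i, x' i (x i) = 1
  apply_ne : ∀ i j, i ≠ j → x' i (x j) = 0
  dense_span : closure (Submodule.span 𝕜 (range x) : Set X) = Set.univ
  separates : ∀ y z : X, (∀ i, x' i y = x' i z) → y = z

/-- Strong Markushevich basis. -/
def IsStrongMarkushevichBasis {Λ : Type u} (x : Λ → X) (x' : Λ → StrongDual 𝕜 X) : Prop :=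
  IsMarkushevichBasis x x' ∧
    ∀ y : X, y ∈ closure (Submodule.span 𝕜 (x '' {i | x' i y ≠ 0}) : Set X)

/-- `D` is the `Σ`-subspace of `X*` generated by the linearly dense set `M`. -/
def IsSigmaSubspaceOf (D : Submodule 𝕜 (StrongDual 𝕜 X)) (M : Set X) : Prop :=
  closure (Submodule.span 𝕜 M : Set X) = Set.univ ∧
    ∀ φ : StrongDual 𝕜 X, φ ∈ D ↔ {x ∈ M | φ x ≠ 0}.Countable

/-- The topology `σ(X, D)`: the weakest topology on `X` making all elements of `D` continuous. -/
abbrev sigmaTop (D : Submodule 𝕜 (StrongDual 𝕜 X)) : TopologicalSpace X :=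
  ⨅ φ ∈ D, TopologicalSpace.induced (fun x : X => φ x) inferInstance

/-- `D` contains the weak* closure of each of its countable subsets. -/
def WeakStarCountablyClosed (D : Submodule 𝕜 (StrongDual 𝕜 X)) : Prop :=
  ∀ C : Set (StrongDual 𝕜 X), C.Countable → C ⊆ D →
    ∀ φ : StrongDual 𝕜 X,
      StrongDual.toWeakDual φ ∈ closure (StrongDual.toWeakDual '' C : Set (WeakDual 𝕜 X)) → φ ∈ D

/-- `(P_s)_{s ∈ Γ}` is a projectional skeleton on `X`. -/
structure IsProjectionalSkeleton {Γ : Type u} [PartialOrder Γ] (P : Γ → (X →L[𝕜] X)) : Prop where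
  directed : ∀ s t : Γ, ∃ r, s ≤ r ∧ t ≤ r
  separable : ∀ s, TopologicalSpace.IsSeparable (range (P s))
  mul : ∀ s t, s ≤ t → P s * P t = P s ∧ P t * P s = P s
  sup : ∀ σ : ℕ → Γ, Monotone σ →
    ∃ s, IsLUB (range σ) s ∧ range (P s) = closure (⋃ n, range (P (σ n)))
  exhausts : (⋃ s, range (P s)) = Set.univ

/-- The subspace `D` of `X*` is induced by the skeleton `(P_s)`: it is the union of the ranges of
the adjoint projections `P_s^*`. -/
def InducedBy {Γ : Type u} (D : Submodule 𝕜 (StrongDual 𝕜 X)) (P : Γ → (X →L[𝕜] X)) : Prop :=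
  ∀ φ : StrongDual 𝕜 X, φ ∈ D ↔ ∃ s, ∃ ψ : StrongDual 𝕜 X, φ = ψ.comp (P s)

end General

/-- The one-point lindelöfication of the discrete set `Γ`; the point `∞` is `none`. -/
def LindelofOne (Γ : Type u) : Type u := Option Γ

/-- The point `∞`. -/
def LindelofOne.infty {Γ : Type u} : LindelofOne Γ := (none : Option Γ)

/-- Points of `Γ` are isolated, the neighbourhoods of `∞` are the sets containing `∞` whose
complement is countable. -/
instance (Γ : Type u) : TopologicalSpace (LindelofOne Γ) where
  IsOpen U := (LindelofOne.infty : LindelofOne Γ) ∈ U → Uᶜ.Countable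
  isOpen_univ := by intro _; simp
  isOpen_inter U V hU hV h := by
    rw [Set.compl_inter]; exact (hU h.1).union (hV h.2)
  isOpen_sUnion S hS h := by
    obtain ⟨U, hUS, hU⟩ := h
    exact (hS U hUS hU).mono (compl_subset_compl.2 (subset_sUnion_of_mem hUS))

/-- The subset `s` of the topological space `Y`, with the subspace topology, is primarily
Lindelöf: a continuous image of a closed subset of a countable power of some `LindelofOne Γ`. -/
def IsPrimarilyLindelof {Y : Type v} [TopologicalSpace Y] (s : Set Y) : Prop :=
  ∃ (Γ : Type v) (F : Set (ℕ → LindelofOne Γ)) (g : (ℕ → LindelofOne Γ) → Y),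
    IsClosed F ∧ ContinuousOn g F ∧ g '' F = s

end BanachBasis

/-! ### The ordinal segment `[0, η]` and the space `C([0, η])` -/

namespace OrdinalSegment

open BanachBasis

universe u

/-- The segment `[0, η]`, with the order topology. -/
abbrev Seg (η : Ordinal.{u}) : Type (u + 1) := Set.Iic η

instance (η : Ordinal.{u}) : CompactSpace (Seg η) := by
  rw [← isCompact_iff_compactSpace, ← Set.Icc_bot]
  exact isCompact_Icc

/-- The set `I(η)` of the isolated ordinals of `[0, η]` (zero and successors). -/
abbrev Iso (η : Ordinal.{u}) : Set Ordinal.{u} := {x | x ≤ η ∧ ¬ Order.IsSuccLimit x}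

/-- The ordinal `0` as an element of `I(η)`. -/
def isoZero (η : Ordinal.{u}) : Iso η := ⟨0, zero_le, by simp⟩

/-- The ordinal `a + 1` as an element of `I(η)`, for `a < η`. -/
def isoSucc {η a : Ordinal.{u}} (ha : a < η) : Iso η :=
  ⟨a + 1, by simpa using Order.succ_le_of_lt ha,
    by simp⟩

theorem isClopen_interval {η : Ordinal.{u}} (a : Iso η) (b : Ordinal.{u}) :
    IsClopen {x : Seg η | (a : Ordinal.{u}) ≤ x ∧ (x : Ordinal.{u}) ≤ b} := by
  have h1 : IsClopen {x : Ordinal.{u} | (a : Ordinal.{u}) ≤ x ∧ x ≤ b} := by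
    refine ⟨isClosed_Icc, ?_⟩
    rw [SuccOrder.isOpen_iff]
    rintro o ⟨ho1, ho2⟩ hl
    have hne : (a : Ordinal.{u}) ≠ o := by
      intro h
      exact a.2.2 (h ▸ hl)
    exact ⟨a, lt_of_le_of_ne ho1 hne, fun x hx => ⟨hx.1.le, hx.2.le.trans ho2⟩⟩
  exact h1.preimage continuous_subtype_val

variable (𝕜 : Type) [RCLike 𝕜]

/-- The characteristic function `χ_{[a, b]}`, for `a` isolated, as an element of `C([0, η])`. -/
noncomputable def chi {η : Ordinal.{u}} (a : Iso η) (b : Ordinal.{u}) : C(Seg η, 𝕜) where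
  toFun := Set.indicator {x : Seg η | (a : Ordinal.{u}) ≤ x ∧ (x : Ordinal.{u}) ≤ b} 1
  continuous_toFun := by
    rw [← LocallyConstant.coe_charFn 𝕜 (isClopen_interval a b)]
    exact (LocallyConstant.charFn 𝕜 (isClopen_interval a b)).continuous

variable {𝕜}

/-- The Dirac measure `δ_x`, as a functional on `C([0, η])`. -/
noncomputable def dirac {η : Ordinal.{u}} (x : Seg η) : StrongDual 𝕜 C(Seg η, 𝕜) :=
  ContinuousMap.evalCLM 𝕜 x

variable (𝕜)

/-- The subspace `D(η)` of the dual of `C([0, η])`. As `[0, η]` is compact and scattered, its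
Radon measures are exactly the sums `∑ c_x δ_x` with `(c_x)` absolutely summable, the mass of the
point `x` being `c_x`. `D(η)` consists of the measures with no mass at the points of uncountable
cofinality. -/
noncomputable def dualD (η : Ordinal.{u}) : Submodule 𝕜 (StrongDual 𝕜 C(Seg η, 𝕜)) where
  carrier := {φ | ∃ c : Seg η → 𝕜, Summable (fun x => ‖c x‖) ∧
    (∀ x : Seg η, ℵ₀ < (x : Ordinal.{u}).cof → c x = 0) ∧
    ∀ f : C(Seg η, 𝕜), HasSum (fun x => c x * f x) (φ f)}
  zero_mem' := ⟨0, by simp, by simp, fun f => by simp⟩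
  add_mem' := by
    rintro φ ψ ⟨c, hc, hc0, hφ⟩ ⟨d, hd, hd0, hψ⟩
    refine ⟨c + d, ?_, fun x hx => by simp [hc0 x hx, hd0 x hx], fun f => ?_⟩
    · exact Summable.of_nonneg_of_le (fun x => norm_nonneg _) (fun x => norm_add_le _ _)
        (hc.add hd)
    · simpa [add_mul] using (hφ f).add (hψ f)
  smul_mem' := by
    rintro a φ ⟨c, hc, hc0, hφ⟩
    refine ⟨a • c, ?_, fun x hx => by simp [hc0 x hx], fun f => ?_⟩
    · simpa [norm_mul] using hc.mul_left ‖a‖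
    · simpa [mul_assoc] using (hφ f).mul_left a

variable {𝕜}

/-- The initial ordinal `κ` of the cardinality of `η`. -/
noncomputable abbrev kap (η : Ordinal.{u}) : Ordinal.{u} := η.card.ord

/-- `A_α`, the closure of `ξ([0, α] ∩ I(κ))`. (`[0, η]` is closed in the class of ordinals, so the
closure can be taken there.) -/
def setA {η : Ordinal.{u}} (ξ : Iso (kap η) ≃ Iso η) (α : Ordinal.{u}) : Set Ordinal.{u} :=
  closure ((fun β : Iso (kap η) => (ξ β : Ordinal.{u})) '' {β | (β : Ordinal.{u}) ≤ α})

/-- `r_A(x) = max ([0, x] ∩ A)`, for a set `A` that is closed and contains `0`. -/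
noncomputable def retr {η : Ordinal.{u}} (A : Set Ordinal.{u}) (x : Seg η) : Seg η :=
  ⟨sSup (Set.Iic (x : Ordinal.{u}) ∩ A), (csSup_le' (fun _ hy => hy.1 : (x : Ordinal.{u}) ∈ upperBounds _)).trans x.2⟩

/-- The set `{y ∈ [x, η] : [x, y] ∩ A_α = ∅}`. -/
def zSet {η : Ordinal.{u}} (ξ : Iso (kap η) ≃ Iso η) (x α : Ordinal.{u}) : Set Ordinal.{u} :=
  {y | x ≤ y ∧ y ≤ η ∧ Set.Icc x y ∩ setA ξ α = ∅}

/-- `z(x, α) = max {y ∈ [x, η] : [x, y] ∩ A_α = ∅}`, for `x ∈ [0, η] \ A_α`. -/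
noncomputable def zMax {η : Ordinal.{u}} (ξ : Iso (kap η) ≃ Iso η) (x α : Ordinal.{u}) :
    Ordinal.{u} := sSup (zSet ξ x α)

/-- `p(x, α) = max (A_α ∩ [0, x))`, for `x ∈ [0, η] \ A_α`. -/
noncomputable def pMax {η : Ordinal.{u}} (ξ : Iso (kap η) ≃ Iso η) (x : Seg η) (α : Ordinal.{u}) :
    Seg η :=
  ⟨sSup (setA ξ α ∩ Set.Iio (x : Ordinal.{u})), (csSup_le' (fun _ hy => (Set.mem_Iio.1 hy.2).le : (x : Ordinal.{u}) ∈ upperBounds _)).trans x.2⟩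

/-- The point `ξ(α)` of `[0, η]`. -/
def pt {η : Ordinal.{u}} (ξ : Iso (kap η) ≃ Iso η) (α : Iso (kap η)) : Seg η :=
  ⟨(ξ α : Ordinal.{u}), (ξ α).2.1⟩

/-- The predecessor `α - 1` of an isolated ordinal `α ≥ 1`. -/
noncomputable def prd {κ : Ordinal.{u}} (α : Iso κ) : Ordinal.{u} :=
  Ordinal.pred (α : Ordinal.{u})

variable (𝕜)

open Classical in
/-- `f_0 = 1` and `f_α = χ_{[ξ(α), z(ξ(α), α - 1)]}` for `α ≥ 1`. -/
noncomputable def basisFun {η : Ordinal.{u}} (ξ : Iso (kap η) ≃ Iso η) (α : Iso (kap η)) :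
    C(Seg η, 𝕜) :=
  if (α : Ordinal.{u}) = 0 then 1 else chi 𝕜 (ξ α) (zMax ξ (ξ α) (prd α))

open Classical in
/-- `μ_0 = δ_0` and `μ_α = δ_{ξ(α)} - δ_{p(ξ(α), α - 1)}` for `α ≥ 1`. -/
noncomputable def basisMeas {η : Ordinal.{u}} (ξ : Iso (kap η) ≃ Iso η) (α : Iso (kap η)) :
    StrongDual 𝕜 C(Seg η, 𝕜) :=
  if (α : Ordinal.{u}) = 0 then dirac ⟨0, Set.mem_Iic.2 zero_le⟩
  else dirac (pt ξ α) - dirac (pMax ξ (pt ξ α) (prd α))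

/-- `H = {f_α : α ∈ I(κ)} ∪ {0}`. -/
def setH {η : Ordinal.{u}} (ξ : Iso (kap η) ≃ Iso η) : Set C(Seg η, 𝕜) :=
  Set.range (basisFun 𝕜 ξ) ∪ {0}

/-- `θ = liminf ξ⁻¹(x)`, as `x ∈ [0, a) ∩ I(η)` tends to `a`. -/
noncomputable def theta {η : Ordinal.{u}} (ξ : Iso (kap η) ≃ Iso η) (a : Ordinal.{u}) :
    Ordinal.{u} :=
  Filter.liminf (fun x : Iso η => ((ξ.symm x : Iso (kap η)) : Ordinal.{u}))
    (Filter.comap Subtype.val (𝓝[<] a))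

/-- The functions `χ_{[a + 1, d]}` where `a < η` has uncountable cofinality, `θ < ξ⁻¹(a + 1)` and
`d = min {z(a, γ) : γ < θ}`. -/
def accSet {η : Ordinal.{u}} (ξ : Iso (kap η) ≃ Iso η) : Set C(Seg η, 𝕜) :=
  {g | ∃ (a : Ordinal.{u}) (ha : a < η) (d : Ordinal.{u}), ℵ₀ < a.cof ∧
    theta ξ a < (ξ.symm (isoSucc ha) : Iso (kap η)) ∧
    IsLeast {y | ∃ γ < theta ξ a, y = zMax ξ a γ} d ∧ g = chi 𝕜 (isoSucc ha) d}

end OrdinalSegment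

open BanachBasis OrdinalSegment
universe u

namespace OrdinalSegment

/-! ### Step functions on `[0, η]` -/

section Step

variable {𝕜 : Type} [RCLike 𝕜] {η : Ordinal.{u}}

/-! Everything is read off the enumeration `ξ` through one notion. Call `α` a record at `x` if `ξ(α)
≤ x` and every earlier `ξ(β) ≤ x` lies strictly below `ξ(α)`. Then `f_α(x) = 1` exactly when `α` is
a record at `x` (`basisFun_apply`), while `r_{A_α}(x)` is the supremum of the `ξ(β) ≤ x` with `β ≤
α` (`lt_retr_iff`). Adding the index `α` changes the retraction only where `α` is a record, which
gives `P_α - P_{α-1} = μ_α ⊗ f_α` (`proj_sub_proj_prd`). At a limit `l`, `P_α f → P_l f`: on a step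
function `χ_[0,b]` the projections are eventually constant, and step functions span a dense subspace
(`proj_approx`). Transfinite induction then puts each `f` in the closed span of the `f_α` with
`μ_α(f) ≠ 0`, which is (a).

For (b), a functional is an atomic measure whose masses are the jumps of `b ↦ φ(χ_[0,b])`
(`exists_hasSum`). If `η < ω_2`, all indices are countable ordinals, so countably many of them have
a countable bound `β`. A point of countable cofinality lies in `A_β` for large countable `β`, a
point of uncountable cofinality in no such `A_β`. Hence `φ ∈ D`, countability of `{α : φ(f_α) ≠ 0}`,
and `φ = φ ∘ P_β` for some countable `β` are equivalent (`mem_dualD_iff_countable`,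
`comp_proj_of_countable`). The topological claims and the skeleton `(P_β)` follow.

For (c), elements of `D` live on countable sets of points of countable cofinality, so it suffices to
match `g` on such sets (`mem_closure_sigmaTop`). Near a point `a` of uncountable cofinality the
first `ξ(γ)` in `(b, a]` is a record at `a`, and as `b → a` these `f_γ` approach `χ_[a+1,d]`.
Conversely, a nonzero accumulation point `g` has `μ_α(g) ≠ 0` for some `α` with `μ_α ∉ D`; then `a =
p(ξ(α), α-1)` has uncountable cofinality, and comparing records at `a` and at `ξ(α)` identifies `g`
(`mem_accSet_of_accPt`). -/

theorem isOpen_of_isLowerSet {s : Set (Seg η)} (h : IsLowerSet s) : IsOpen s := by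
  refine isOpen_iff_mem_nhds.2 fun x hx => ?_
  refine mem_of_superset ((isClopen_interval (isoZero η) (x : Ordinal.{u})).isOpen.mem_nhds
    ⟨zero_le, le_rfl⟩) fun y hy => h (show y ≤ x from hy.2) hx

theorem isOpen_Ici_iso (a : Iso η) : IsOpen {x : Seg η | (a : Ordinal.{u}) ≤ x} := by
  convert (isClopen_interval a η).isOpen using 1
  ext x
  simpa using fun _ => Set.mem_Iic.1 x.2

theorem chi_apply (a : Iso η) (b : Ordinal.{u}) (x : Seg η)
    [Decidable ((a : Ordinal.{u}) ≤ x ∧ (x : Ordinal.{u}) ≤ b)] :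
    chi 𝕜 a b x = if (a : Ordinal.{u}) ≤ x ∧ (x : Ordinal.{u}) ≤ b then 1 else 0 := by
  simp only [chi, ContinuousMap.coe_mk, Set.indicator_apply, Set.mem_ofPred_eq, Pi.one_apply]

variable (𝕜) in
/-- The step function `χ_{[0, b]}`. -/
noncomputable def step (b : Ordinal.{u}) : C(Seg η, 𝕜) := chi 𝕜 (isoZero η) b

open Classical in
theorem step_apply (b : Ordinal.{u}) (x : Seg η) :
    step 𝕜 b x = if (x : Ordinal.{u}) ≤ b then 1 else 0 := by
  have h0 : ((isoZero η : Iso η) : Ordinal.{u}) ≤ x := zero_le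
  rw [step, chi_apply]
  simp [h0]

theorem step_mem_span (b : Ordinal.{u}) :
    (step 𝕜 b : C(Seg η, 𝕜)) ∈ Submodule.span 𝕜 (range fun b => (step 𝕜 b : C(Seg η, 𝕜))) :=
  Submodule.subset_span ⟨b, rfl⟩

/-- Transfinite induction on `b`: by continuity `f` is within `ε` of `f(b)` on some `(a, b]`, and a
multiple of `χ_(a,b]` extends the approximation from `[0, a]`. Demanding that `g` vanish beyond `b`
keeps the two pieces from interfering. -/
theorem exists_step_approx (f : C(Seg η, 𝕜)) {ε : ℝ} (hε : 0 < ε) (b : Ordinal.{u}) (hb : b ≤ η) :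
    ∃ g ∈ Submodule.span 𝕜 (range fun b => (step 𝕜 b : C(Seg η, 𝕜))),
      (∀ x : Seg η, b < x → g x = 0) ∧ ∀ x : Seg η, (x : Ordinal.{u}) ≤ b → ‖f x - g x‖ < ε := by
  induction b using WellFoundedLT.induction with
  | ind b ih =>
    have hn : {y : Seg η | ‖f y - f ⟨b, hb⟩‖ < ε} ∈ 𝓝 (⟨b, hb⟩ : Seg η) := by
      have := (f.continuous.tendsto ⟨b, hb⟩).eventually (Metric.ball_mem_nhds _ hε)
      simp only [dist_eq_norm] at this
      exact this
    rcases eq_or_ne b 0 with rfl | h0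
    · refine ⟨f ⟨0, hb⟩ • step 𝕜 0, Submodule.smul_mem _ _ (step_mem_span _), fun x hx => ?_,
        fun x hx => ?_⟩
      · simp [step_apply, hx.ne']
      · have : x = ⟨0, hb⟩ := Subtype.ext (le_antisymm hx zero_le)
        subst this
        simpa [step_apply] using hε
    · obtain ⟨a, ha, hab⟩ := exists_Ioc_subset_of_mem_nhds hn
        ⟨⟨0, Set.mem_Iic.2 zero_le⟩, Subtype.mk_lt_mk.2 (pos_iff_ne_zero.2 h0)⟩
      obtain ⟨g, hg, hg0, hgf⟩ := ih a ha a.2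
      refine ⟨g + f ⟨b, hb⟩ • (step 𝕜 b - step 𝕜 a), Submodule.add_mem _ hg
        (Submodule.smul_mem _ _ (Submodule.sub_mem _ (step_mem_span _) (step_mem_span _))),
        fun x hx => ?_, fun x hx => ?_⟩
      · have hax : (a : Ordinal.{u}) < x := lt_trans ha hx
        simp [step_apply, hx.not_ge, hax.not_ge, hg0 x hax]
      · rcases le_or_gt (x : Ordinal.{u}) a with h | h
        · simpa [step_apply, h, hx] using hgf x h
        · have := @hab x ⟨h, hx⟩
          simpa [step_apply, h.not_ge, hx, hg0 x h] using this

theorem span_step_dense :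
    closure (Submodule.span 𝕜 (range fun b => (step 𝕜 b : C(Seg η, 𝕜))) : Set C(Seg η, 𝕜)) =
      Set.univ := by
  refine Set.eq_univ_of_forall fun f => Metric.mem_closure_iff.2 fun ε hε => ?_
  obtain ⟨g, hg, -, h⟩ := exists_step_approx f hε η le_rfl
  refine ⟨g, hg, ?_⟩
  rw [ContinuousMap.dist_lt_iff hε]
  intro x
  simpa [dist_eq_norm] using h x x.2

end Step

/-! ### The sets `A_α` and the retractions onto them -/

section Retraction

variable {𝕜 : Type} [RCLike 𝕜] {η : Ordinal.{u}} {ξ : Iso (kap η) ≃ Iso η}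

theorem xi_mem_setA {α : Ordinal.{u}} {β : Iso (kap η)} (h : (β : Ordinal.{u}) ≤ α) :
    (ξ β : Ordinal.{u}) ∈ setA ξ α := subset_closure ⟨β, h, rfl⟩

theorem setA_mono {α β : Ordinal.{u}} (h : α ≤ β) : setA ξ α ⊆ setA ξ β :=
  closure_mono (image_mono fun _ hγ => le_trans hγ h)

/-- Points of `A_α` are approximated from the left, within `A_α`, by the points `ξ(β)`. -/
theorem exists_xi_of_mem_setA {α b c : Ordinal.{u}} (hc : c ∈ setA ξ α) (hb : b < c) :
    ∃ β : Iso (kap η), (β : Ordinal.{u}) ≤ α ∧ b < ξ β ∧ (ξ β : Ordinal.{u}) ≤ c := by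
  have : Ioo b (Order.succ c) ∈ 𝓝 c := Ioo_mem_nhds hb (Order.lt_succ c)
  obtain ⟨_, ⟨h1, h2⟩, β, hβ, rfl⟩ := mem_closure_iff_nhds.1 hc _ this
  exact ⟨β, hβ, h1, Order.lt_succ_iff.1 h2⟩

/-- Converse of `exists_xi_of_mem_setA`, since every neighbourhood of `c ≠ 0` contains some `(b,
c]`. Together they turn the closure into a statement about indices. -/
theorem mem_setA_of_forall {α c : Ordinal.{u}} (hc0 : c ≠ 0)
    (h : ∀ b < c, ∃ β : Iso (kap η), (β : Ordinal.{u}) ≤ α ∧ b < ξ β ∧ (ξ β : Ordinal.{u}) ≤ c) :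
    c ∈ setA ξ α := by
  refine mem_closure_iff_nhds.2 fun t ht => ?_
  obtain ⟨b, hb, hbt⟩ := exists_Ioc_subset_of_mem_nhds ht ⟨0, pos_iff_ne_zero.2 hc0⟩
  obtain ⟨β, h1, h2, h3⟩ := h b hb
  exact ⟨_, hbt ⟨h2, h3⟩, β, h1, rfl⟩

theorem zero_mem_setA (hξ : ξ (isoZero (kap η)) = isoZero η) (α : Ordinal.{u}) :
    (0 : Ordinal.{u}) ∈ setA ξ α := by
  have := xi_mem_setA (ξ := ξ) (α := α) (β := isoZero _) zero_le
  rwa [hξ] at this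

theorem retr_isGreatest (hξ : ξ (isoZero (kap η)) = isoZero η) (α : Ordinal.{u}) (x : Seg η) :
    IsGreatest (Set.Iic (x : Ordinal.{u}) ∩ setA ξ α) (retr (setA ξ α) x) := by
  have hb : BddAbove (Set.Iic (x : Ordinal.{u}) ∩ setA ξ α) := ⟨x, fun y hy => hy.1⟩
  exact ⟨(isClosed_Iic.inter isClosed_closure).csSup_mem
    ⟨0, Set.mem_Iic.2 zero_le, zero_mem_setA hξ α⟩ hb,
    fun y hy => le_csSup hb hy⟩

theorem retr_le (α : Ordinal.{u}) (x : Seg η) : (retr (setA ξ α) x : Ordinal.{u}) ≤ x :=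
  csSup_le' fun _ hy => hy.1

/-- Lets later arguments about the retraction handle indices instead of suprema. -/
theorem lt_retr_iff (hξ : ξ (isoZero (kap η)) = isoZero η) {α b : Ordinal.{u}} {x : Seg η} :
    b < retr (setA ξ α) x ↔
      ∃ β : Iso (kap η), (β : Ordinal.{u}) ≤ α ∧ b < ξ β ∧ (ξ β : Ordinal.{u}) ≤ x := by
  constructor
  · intro h
    obtain ⟨β, h1, h2, h3⟩ := exists_xi_of_mem_setA (retr_isGreatest hξ α x).1.2 h
    exact ⟨β, h1, h2, h3.trans (retr_le α x)⟩
  · rintro ⟨β, h1, h2, h3⟩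
    exact h2.trans_le ((retr_isGreatest hξ α x).2 ⟨h3, xi_mem_setA h1⟩)

theorem xi_le_retr (hξ : ξ (isoZero (kap η)) = isoZero η) {α : Ordinal.{u}} {x : Seg η}
    {β : Iso (kap η)} (h : (β : Ordinal.{u}) ≤ α) (hx : (ξ β : Ordinal.{u}) ≤ x) :
    (ξ β : Ordinal.{u}) ≤ retr (setA ξ α) x :=
  (retr_isGreatest hξ α x).2 ⟨hx, xi_mem_setA h⟩

theorem retr_mono (hξ : ξ (isoZero (kap η)) = isoZero η) (α : Ordinal.{u}) :
    Monotone (retr (η := η) (setA ξ α)) := fun x y h =>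
  (retr_isGreatest hξ α y).2 ⟨(retr_le α x).trans h, (retr_isGreatest hξ α x).1.2⟩

theorem retr_eq_self {α : Ordinal.{u}} {x : Seg η} (h : (x : Ordinal.{u}) ∈ setA ξ α) :
    retr (setA ξ α) x = x :=
  Subtype.ext (le_antisymm (retr_le α x) (le_csSup ⟨x, fun _ hy => hy.1⟩ ⟨Set.mem_Iic.2 le_rfl, h⟩))

theorem retr_retr (hξ : ξ (isoZero (kap η)) = isoZero η) {α β : Ordinal.{u}} (h : α ≤ β)
    (x : Seg η) : retr (setA ξ β) (retr (setA ξ α) x) = retr (setA ξ α) x :=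
  retr_eq_self (setA_mono h (retr_isGreatest hξ α x).1.2)

theorem retr_retr' (hξ : ξ (isoZero (kap η)) = isoZero η) {α β : Ordinal.{u}} (h : α ≤ β)
    (x : Seg η) : retr (setA ξ α) (retr (setA ξ β) x) = retr (setA ξ α) x := by
  apply le_antisymm (retr_mono hξ α (retr_le β x))
  have h1 := retr_isGreatest hξ α x
  exact (retr_isGreatest hξ α _).2
    ⟨(retr_isGreatest hξ β x).2 ⟨retr_le α x, setA_mono h h1.1.2⟩, h1.1.2⟩

/-- Preimages of lower rays are lower sets, hence open. Preimages of upper rays are unions of final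
segments `[ξ(β), η]`, open because `ξ(β)` is isolated. -/
theorem continuous_retr (hξ : ξ (isoZero (kap η)) = isoZero η) (α : Ordinal.{u}) :
    Continuous (retr (η := η) (setA ξ α)) := by
  rw [OrderTopology.continuous_iff]
  refine fun b => ⟨?_, isOpen_of_isLowerSet fun _ y hyx hx => (retr_mono hξ α hyx).trans_lt hx⟩
  have : retr (setA ξ α) ⁻¹' Ioi b =
      ⋃ β : {β : Iso (kap η) // (β : Ordinal.{u}) ≤ α ∧ (b : Ordinal.{u}) < ξ β},
        {x : Seg η | (ξ β.1 : Ordinal.{u}) ≤ x} := by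
    ext x
    simp only [mem_preimage, mem_Ioi, mem_iUnion, Set.mem_ofPred_eq, Subtype.exists, exists_prop]
    rw [← Subtype.coe_lt_coe, lt_retr_iff hξ]
    simp [and_assoc]
  rw [this]
  exact isOpen_iUnion fun β => isOpen_Ici_iso _

variable (𝕜) in
/-- The operator `P_α f = f ∘ r_{A_α}`. -/
noncomputable def proj (hξ : ξ (isoZero (kap η)) = isoZero η) (α : Ordinal.{u}) :
    C(Seg η, 𝕜) →L[𝕜] C(Seg η, 𝕜) :=
  LinearMap.mkContinuous
    { toFun := fun f => f.comp ⟨retr (setA ξ α), continuous_retr hξ α⟩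
      map_add' := fun _ _ => rfl
      map_smul' := fun _ _ => rfl } 1 fun f => by
    rw [one_mul]
    exact (ContinuousMap.norm_le _ (norm_nonneg f)).2 fun _ => f.norm_coe_le_norm _

variable {hξ : ξ (isoZero (kap η)) = isoZero η}

@[simp] theorem proj_apply (α : Ordinal.{u}) (f : C(Seg η, 𝕜)) (x : Seg η) :
    proj 𝕜 hξ α f x = f (retr (setA ξ α) x) := rfl

theorem norm_proj_apply_le (α : Ordinal.{u}) (f : C(Seg η, 𝕜)) : ‖proj 𝕜 hξ α f‖ ≤ ‖f‖ :=
  (ContinuousMap.norm_le _ (norm_nonneg f)).2 fun _ => f.norm_coe_le_norm _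

theorem proj_proj {α β : Ordinal.{u}} (h : α ≤ β) (f : C(Seg η, 𝕜)) :
    proj 𝕜 hξ α (proj 𝕜 hξ β f) = proj 𝕜 hξ α f := by
  ext x; simp [retr_retr hξ h]

theorem proj_proj' {α β : Ordinal.{u}} (h : α ≤ β) (f : C(Seg η, 𝕜)) :
    proj 𝕜 hξ β (proj 𝕜 hξ α f) = proj 𝕜 hξ α f := by
  ext x; simp [retr_retr' hξ h]

theorem proj_mul {α β : Ordinal.{u}} (h : α ≤ β) :
    proj 𝕜 hξ α * proj 𝕜 hξ β = proj 𝕜 hξ α ∧ proj 𝕜 hξ β * proj 𝕜 hξ α = proj 𝕜 hξ α :=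
  ⟨ContinuousLinearMap.ext fun f => (proj_proj h f : (proj 𝕜 hξ α) ((proj 𝕜 hξ β) f) = _),
    ContinuousLinearMap.ext fun f => (proj_proj' h f : (proj 𝕜 hξ β) ((proj 𝕜 hξ α) f) = _)⟩

theorem mem_range_proj {α : Ordinal.{u}} {f : C(Seg η, 𝕜)} :
    f ∈ range (proj 𝕜 hξ α) ↔ proj 𝕜 hξ α f = f :=
  ⟨by rintro ⟨g, rfl⟩; exact proj_proj le_rfl g, fun h => ⟨f, h⟩⟩

theorem range_proj_mono {α β : Ordinal.{u}} (h : α ≤ β) :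
    range (proj 𝕜 hξ α) ⊆ range (proj 𝕜 hξ β) := by
  rintro _ ⟨f, rfl⟩
  exact ⟨_, proj_proj' h f⟩

theorem isClosed_range_proj (α : Ordinal.{u}) : IsClosed (range (proj 𝕜 hξ α)) := by
  have : range (proj 𝕜 hξ α) = {f | proj 𝕜 hξ α f = f} := ext fun f => mem_range_proj
  rw [this]
  exact isClosed_eq (proj 𝕜 hξ α).continuous continuous_id

theorem kap_isSuccLimit (hη : Ordinal.omega0 ≤ η) : Order.IsSuccLimit (kap η) :=
  Cardinal.isSuccLimit_ord (by simpa using Ordinal.card_le_card hη)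

theorem iso_lt_kap (hη : Ordinal.omega0 ≤ η) (α : Iso (kap η)) : (α : Ordinal.{u}) < kap η :=
  lt_of_le_of_ne α.2.1 fun h => α.2.2 (by rw [h]; exact kap_isSuccLimit hη)

/-- At limit stages the projections stabilise on each step function. -/
theorem proj_step_eventually {l : Ordinal.{u}} (hl : Order.IsSuccLimit l) (b : Ordinal.{u}) :
    ∃ α < l, ∀ γ, α ≤ γ → γ ≤ l →
      proj 𝕜 hξ γ (step 𝕜 b) = (proj 𝕜 hξ l (step 𝕜 b) : C(Seg η, 𝕜)) := by
  by_cases h : ∃ β : Iso (kap η), (β : Ordinal.{u}) ≤ l ∧ b < ξ β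
  · obtain ⟨m, ⟨β, ⟨hβ, hbβ⟩, rfl⟩, hm⟩ := WellFounded.has_min (wellFounded_lt (α := Ordinal.{u}))
      ((fun β : Iso (kap η) => (ξ β : Ordinal.{u})) ''
        {β | (β : Ordinal.{u}) ≤ l ∧ b < ξ β}) (by obtain ⟨β, hβ⟩ := h; exact ⟨_, β, hβ, rfl⟩)
    -- `ξ(β)` is the least value above `b` with index at most `l`. Since `β` is isolated and `l` a
    -- limit, `β < l`; from stage `β` on, `b < r(x)` just means `ξ(β) ≤ x`.
    refine ⟨β, lt_of_le_of_ne hβ fun h => β.2.2 (h ▸ hl), fun γ hγ hγl => ?_⟩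
    ext x
    have : ∀ δ, (β : Ordinal.{u}) ≤ δ → δ ≤ l →
        (b < retr (setA ξ δ) x ↔ (ξ β : Ordinal.{u}) ≤ x) := by
      intro δ hδ hδl
      rw [lt_retr_iff hξ]
      refine ⟨?_, fun h => ⟨β, hδ, hbβ, h⟩⟩
      rintro ⟨β', h1, h2, h3⟩
      exact (not_lt.1 (hm _ ⟨β', ⟨h1.trans hδl, h2⟩, rfl⟩)).trans h3
    simp only [proj_apply, step_apply, ← not_lt, this γ hγ hγl, this l hβ le_rfl]
  · refine ⟨0, hl.bot_lt, fun γ _ hγl => ?_⟩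
    ext x
    have : ∀ δ ≤ l, ¬ b < retr (setA ξ δ) x := by
      intro δ hδ
      rw [lt_retr_iff hξ]
      rintro ⟨β', h1, h2, h3⟩
      exact h ⟨β', h1.trans hδ, h2⟩
    simp only [proj_apply, step_apply, ← not_lt, this γ hγl, this l le_rfl]

/-- `P_α f → P_l f` as `α → l`. -/
theorem proj_approx {l : Ordinal.{u}} (hl : Order.IsSuccLimit l) (f : C(Seg η, 𝕜)) {ε : ℝ}
    (hε : 0 < ε) : ∃ α < l, ∀ γ, α ≤ γ → γ ≤ l → ‖proj 𝕜 hξ γ f - proj 𝕜 hξ l f‖ < ε := by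
  have key : ∀ g ∈ Submodule.span 𝕜 (range fun b => (step 𝕜 b : C(Seg η, 𝕜))),
      ∃ α < l, ∀ γ, α ≤ γ → γ ≤ l → proj 𝕜 hξ γ g = proj 𝕜 hξ l g := by
    intro g hg
    induction hg using Submodule.span_induction with
    | mem g hg => obtain ⟨b, rfl⟩ := hg; exact proj_step_eventually hl b
    | zero => exact ⟨0, hl.bot_lt, by simp⟩
    | add g h _ _ hg hh =>
      obtain ⟨α, hα, h1⟩ := hg
      obtain ⟨β, hβ, h2⟩ := hh
      refine ⟨max α β, max_lt hα hβ, fun γ hγ hγl => ?_⟩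
      rw [map_add, map_add, h1 γ ((le_max_left _ _).trans hγ) hγl,
        h2 γ ((le_max_right _ _).trans hγ) hγl]
    | smul c g _ hg =>
      obtain ⟨α, hα, h1⟩ := hg
      exact ⟨α, hα, fun γ hγ hγl => by rw [map_smul, map_smul, h1 γ hγ hγl]⟩
  obtain ⟨g, hg, hfg⟩ := Metric.mem_closure_iff.1
    ((span_step_dense (𝕜 := 𝕜) (η := η)).ge (mem_univ f)) (ε / 2) (half_pos hε)
  obtain ⟨α, hα, h⟩ := key g hg
  refine ⟨α, hα, fun γ hγ hγl => ?_⟩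
  -- The projections agree on `g`, so only the error `f - g` remains, and both projections are
  -- contractions.
  have e : proj 𝕜 hξ γ f - proj 𝕜 hξ l f = proj 𝕜 hξ γ (f - g) - proj 𝕜 hξ l (f - g) := by
    rw [map_sub, map_sub, h γ hγ hγl]; abel
  rw [e]
  rw [dist_eq_norm] at hfg
  calc _ ≤ ‖proj 𝕜 hξ γ (f - g)‖ + ‖proj 𝕜 hξ l (f - g)‖ := norm_sub_le _ _
    _ ≤ ‖f - g‖ + ‖f - g‖ := add_le_add (norm_proj_apply_le _ _) (norm_proj_apply_le _ _)
    _ < ε := by linarith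

theorem range_proj_limit {l : Ordinal.{u}} (hl : Order.IsSuccLimit l) :
    range (proj 𝕜 hξ l) = closure (⋃ α < l, range (proj 𝕜 hξ α)) := by
  apply Subset.antisymm
  · rintro _ ⟨f, rfl⟩
    refine Metric.mem_closure_iff.2 fun ε hε => ?_
    obtain ⟨α, hα, h⟩ := proj_approx (hξ := hξ) hl f hε
    refine ⟨proj 𝕜 hξ α f, by simpa using ⟨α, hα, f, rfl⟩, ?_⟩
    rw [dist_comm, dist_eq_norm]
    exact h α le_rfl hα.le
  · refine closure_minimal ?_ (isClosed_range_proj l)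
    simp only [iUnion_subset_iff]
    exact fun α hα => range_proj_mono hα.le

/-- If `r(x) < x`, then `r(x) + 1 ≤ x` is isolated, hence some `ξ(β)`, contradicting the maximality
of `r(x)`. -/
theorem proj_kap : proj 𝕜 hξ (kap η) = 1 := by
  ext f x
  simp only [proj_apply, one_apply_eq_self]
  congr 1
  refine le_antisymm (retr_le _ x) (not_lt.1 fun h => ?_)
  have hs : Order.succ (retr (setA ξ (kap η)) x : Ordinal.{u}) ≤ x := Order.succ_le_of_lt h
  let y : Iso η := ⟨_, hs.trans x.2, by simp⟩
  have := xi_le_retr hξ (x := x) (α := kap η) (β := ξ.symm y) (ξ.symm y).2.1 (by simpa [y] using hs)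
  simp [y] at this

end Retraction

end OrdinalSegment

namespace OrdinalSegment

/-! ### The functions `f_α` and the functionals `μ_α` -/

section Basis

variable {𝕜 : Type} [RCLike 𝕜] {η : Ordinal.{u}} {ξ : Iso (kap η) ≃ Iso η}

/-- A point of `A_γ` in `(x, y]` has some `ξ(β)` with `β ≤ γ` below it in that interval, so only the
generating points need to be avoided. -/
theorem mem_zSet_iff {x γ y : Ordinal.{u}} (hx : x ∉ setA ξ γ) :
    y ∈ zSet ξ x γ ↔ x ≤ y ∧ y ≤ η ∧
      ∀ β : Iso (kap η), (β : Ordinal.{u}) ≤ γ → x ≤ ξ β → y < ξ β := by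
  refine and_congr_right fun hxy => and_congr_right fun hy => ?_
  constructor
  · intro h β hβ hxβ
    by_contra! hβy
    exact (h ▸ ⟨Set.mem_Icc.2 ⟨hxβ, hβy⟩, xi_mem_setA hβ⟩ :
      (ξ β : Ordinal.{u}) ∈ (∅ : Set Ordinal.{u}))
  · refine fun h => Set.eq_empty_of_forall_notMem fun t ht => ?_
    have hxt : x < t := lt_of_le_of_ne ht.1.1 fun e => hx (e ▸ ht.2)
    obtain ⟨β, h1, h2, h3⟩ := exists_xi_of_mem_setA ht.2 hxt
    exact (h β h1 h2.le).not_ge (h3.trans ht.1.2)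

theorem zMax_isGreatest {x γ : Ordinal.{u}} (hxη : x ≤ η) (hx0 : x ≠ 0) (hx : x ∉ setA ξ γ) :
    IsGreatest (zSet ξ x γ) (zMax ξ x γ) := by
  have hb : BddAbove (zSet ξ x γ) := ⟨η, fun y hy => hy.2.1⟩
  have hxz : x ∈ zSet ξ x γ := (mem_zSet_iff hx).2 ⟨le_rfl, hxη, fun β hβ h =>
    lt_of_le_of_ne h fun e => hx (e ▸ xi_mem_setA hβ)⟩
  refine ⟨(mem_zSet_iff hx).2 ⟨le_csSup hb hxz, csSup_le' fun y hy => hy.2.1, fun β hβ h => ?_⟩,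
    fun y hy => le_csSup hb hy⟩
  by_contra! hβ'
  -- `ξ(β)` is a nonzero isolated ordinal: if the supremum reached it, some element of the set would
  -- already exceed its predecessor and so reach it too.
  have hlt : Ordinal.pred (ξ β : Ordinal.{u}) < ξ β := by
    rw [Ordinal.pred_lt_iff_not_isSuccPrelimit, Order.isSuccPrelimit_iff_isSuccLimit_of_not_isMin]
    · exact (ξ β).2.2
    · exact fun hm => hx0 (le_antisymm (h.trans (hm zero_le)) zero_le)
  obtain ⟨y, hy, hy'⟩ := exists_lt_of_lt_csSup ⟨x, hxz⟩ (hlt.trans_le hβ')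
  have h1 : (ξ β : Ordinal.{u}) ≤ y := by
    have := Order.succ_le_of_lt hy'
    exact (Ordinal.self_le_succ_pred _).trans this
  exact (((mem_zSet_iff hx).1 hy).2.2 β hβ h).not_ge h1

theorem le_zMax_iff {x γ y : Ordinal.{u}} (hxη : x ≤ η) (hx0 : x ≠ 0) (hx : x ∉ setA ξ γ)
    (hxy : x ≤ y) (hy : y ≤ η) : y ≤ zMax ξ x γ ↔
      ∀ β : Iso (kap η), (β : Ordinal.{u}) ≤ γ → x ≤ ξ β → y < ξ β := by
  have hg := zMax_isGreatest hxη hx0 hx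
  refine ⟨fun h β hβ hxβ => h.trans_lt (((mem_zSet_iff hx).1 hg.1).2.2 β hβ hxβ), fun h =>
    hg.2 ((mem_zSet_iff hx).2 ⟨hxy, hy, h⟩)⟩

theorem pMax_eq_retr {x : Seg η} {γ : Ordinal.{u}} (hx : (x : Ordinal.{u}) ∉ setA ξ γ) :
    pMax ξ x γ = retr (setA ξ γ) x := by
  refine Subtype.ext (congrArg sSup ?_)
  ext y
  simp only [mem_inter_iff, mem_Iio, mem_Iic]
  refine ⟨fun h => ⟨h.2.le, h.1⟩, fun h => ⟨h.2, lt_of_le_of_ne h.1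
    fun e => hx (by rw [← e]; exact h.2)⟩⟩

theorem pMax_isGreatest (hξ : ξ (isoZero (kap η)) = isoZero η) {x : Seg η} {γ : Ordinal.{u}}
    (hx : (x : Ordinal.{u}) ∉ setA ξ γ) :
    IsGreatest (setA ξ γ ∩ Set.Iio (x : Ordinal.{u})) (pMax ξ x γ) := by
  have h := retr_isGreatest hξ γ x
  rw [pMax_eq_retr hx]
  refine ⟨⟨h.1.2, lt_of_le_of_ne h.1.1
      fun (e : (retr (setA ξ γ) x : Ordinal.{u}) = x) => hx (e ▸ h.1.2)⟩,
    fun y hy => h.2 ⟨?_, hy.1⟩⟩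
  exact (Set.mem_Iio.1 hy.2).le

theorem xi_eq_zero_iff (hξ : ξ (isoZero (kap η)) = isoZero η) {β : Iso (kap η)} :
    (ξ β : Ordinal.{u}) = 0 ↔ (β : Ordinal.{u}) = 0 := by
  constructor
  · intro h
    have : ξ β = ξ (isoZero _) := by rw [hξ]; exact Subtype.ext h
    exact congrArg Subtype.val (ξ.injective this)
  · intro h
    have : β = isoZero _ := Subtype.ext h
    rw [this, hξ]; rfl

/-- An isolated ordinal lies in the closure only if it is one of the points, and `ξ` is injective.
-/
theorem xi_mem_setA_iff (hξ : ξ (isoZero (kap η)) = isoZero η) {β : Iso (kap η)} {γ : Ordinal.{u}} :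
    (ξ β : Ordinal.{u}) ∈ setA ξ γ ↔ (β : Ordinal.{u}) ≤ γ := by
  refine ⟨fun h => ?_, xi_mem_setA⟩
  by_cases h0 : (ξ β : Ordinal.{u}) = 0
  · rw [(xi_eq_zero_iff hξ).1 h0]; exact zero_le
  have hlt : Ordinal.pred (ξ β : Ordinal.{u}) < ξ β := by
    rw [Ordinal.pred_lt_iff_not_isSuccPrelimit, Order.isSuccPrelimit_iff_isSuccLimit_of_not_isMin]
    · exact (ξ β).2.2
    · exact fun hm => h0 (le_antisymm (hm zero_le) zero_le)
  obtain ⟨β', h1, h2, h3⟩ := exists_xi_of_mem_setA h hlt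
  have h4 : (ξ β : Ordinal.{u}) ≤ ξ β' :=
    (Ordinal.self_le_succ_pred _).trans (Order.succ_le_of_lt h2)
  have : β' = β := ξ.injective (Subtype.ext (le_antisymm h3 h4))
  exact this ▸ h1

theorem le_prd_iff {κ : Ordinal.{u}} {α : Iso κ} (h0 : (α : Ordinal.{u}) ≠ 0) {β : Ordinal.{u}} :
    β ≤ prd α ↔ β < α := by
  have : Order.succ (prd α) = α := by
    rw [prd, Ordinal.succ_pred_eq_iff_not_isSuccPrelimit,
      Order.isSuccPrelimit_iff_isSuccLimit_of_not_isMin]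
    · exact α.2.2
    · exact fun hm => h0 (le_antisymm (hm zero_le) zero_le)
  rw [← Order.lt_succ_iff, this]

/-- `ξ(α)` is a strict record: it is at most `x`, and larger than all `ξ(β) ≤ x` with `β < α`. -/
def IsRecord (ξ : Iso (kap η) ≃ Iso η) (α : Iso (kap η)) (x : Ordinal.{u}) : Prop :=
  (ξ α : Ordinal.{u}) ≤ x ∧
    ∀ β : Iso (kap η), (β : Ordinal.{u}) < α → (ξ β : Ordinal.{u}) ≤ x → (ξ β : Ordinal.{u}) < ξ α

theorem isRecord_self (α : Iso (kap η)) : IsRecord ξ α (ξ α) :=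
  ⟨le_rfl, fun _ hβ h => lt_of_le_of_ne h fun e => hβ.ne (congrArg Subtype.val
    (ξ.injective (Subtype.ext e)))⟩

theorem xi_notMem_setA_prd (hξ : ξ (isoZero (kap η)) = isoZero η) {α : Iso (kap η)}
    (h0 : (α : Ordinal.{u}) ≠ 0) : (ξ α : Ordinal.{u}) ∉ setA ξ (prd α) := by
  rw [xi_mem_setA_iff hξ, le_prd_iff h0]
  exact lt_irrefl _

open Classical in
-- The upper end `z(ξ(α), α-1)` is the last point before some earlier `ξ(β) ≥ ξ(α)` appears, that
-- is, before `α` stops being a record.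
theorem basisFun_apply (hξ : ξ (isoZero (kap η)) = isoZero η) (α : Iso (kap η)) (x : Seg η) :
    basisFun 𝕜 ξ α x = if IsRecord ξ α x then 1 else 0 := by
  rw [basisFun]
  split_ifs with h h' h'
  · rfl
  · refine absurd ⟨?_, fun _ hβ => ?_⟩ h'
    · rw [(xi_eq_zero_iff hξ).2 h]; exact zero_le
    · exact absurd (h ▸ hβ) not_lt_zero
  all_goals
    have key : ((ξ α : Ordinal.{u}) ≤ x ∧ (x : Ordinal.{u}) ≤ zMax ξ (ξ α) (prd α)) ↔
        IsRecord ξ α x := by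
      refine and_congr_right fun hx => ?_
      rw [le_zMax_iff (ξ α).2.1 ((xi_eq_zero_iff hξ).not.2 h) (xi_notMem_setA_prd hξ h) hx x.2]
      refine forall_congr' fun _ => ?_
      rw [le_prd_iff h, ← not_lt (a := (x : Ordinal.{u})), ← not_le (a := (ξ α : Ordinal.{u}))]
      tauto
    rw [chi_apply]
    simp [key, h']

theorem basisFun_apply_eq_one (hξ : ξ (isoZero (kap η)) = isoZero η) {α : Iso (kap η)} {x : Seg η} :
    basisFun 𝕜 ξ α x = 1 ↔ IsRecord ξ α x := by
  classical
  rw [basisFun_apply hξ]; split_ifs with h <;> simp [h]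

theorem basisFun_apply_eq_zero (hξ : ξ (isoZero (kap η)) = isoZero η) {α : Iso (kap η)}
    {x : Seg η} : basisFun 𝕜 ξ α x = 0 ↔ ¬ IsRecord ξ α x := by
  classical
  rw [basisFun_apply hξ]; split_ifs with h <;> simp [h]

theorem isRecord_retr_iff (hξ : ξ (isoZero (kap η)) = isoZero η) {β : Iso (kap η)} {γ : Ordinal.{u}}
    (h : (β : Ordinal.{u}) ≤ γ) {x : Seg η} :
    IsRecord ξ β (retr (setA ξ γ) x) ↔ IsRecord ξ β x := by
  have key : ∀ β' : Iso (kap η), (β' : Ordinal.{u}) ≤ γ →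
      ((ξ β' : Ordinal.{u}) ≤ retr (setA ξ γ) x ↔ (ξ β' : Ordinal.{u}) ≤ x) := fun β' h' =>
    ⟨fun h => h.trans (retr_le γ x), fun h => xi_le_retr hξ h' h⟩
  refine and_congr (key β h) (forall_congr' fun β' => forall_congr' fun hβ' => ?_)
  rw [key β' (hβ'.le.trans h)]

/-- The point `r(x)` lies in `A_γ` and differs from `ξ(β)`, so if `ξ(β)` is below it, an index at
most `γ` has its value in `(ξ(β), r(x)]`. -/
theorem not_isRecord_retr (hξ : ξ (isoZero (kap η)) = isoZero η) {β : Iso (kap η)} {γ : Ordinal.{u}}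
    (h : γ < β) {x : Seg η} : ¬ IsRecord ξ β (retr (setA ξ γ) x) := by
  intro hr
  have hm := (retr_isGreatest hξ γ x).1.2
  have hlt : (ξ β : Ordinal.{u}) < retr (setA ξ γ) x := lt_of_le_of_ne hr.1 fun e =>
    h.not_ge ((xi_mem_setA_iff hξ).1 (e ▸ hm))
  obtain ⟨β', h1, h2, h3⟩ := exists_xi_of_mem_setA hm hlt
  exact (hr.2 β' (h1.trans_lt h) h3).not_gt h2

theorem proj_basisFun_of_le (hξ : ξ (isoZero (kap η)) = isoZero η)
    {β : Iso (kap η)} {γ : Ordinal.{u}} (h : (β : Ordinal.{u}) ≤ γ) :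
    proj 𝕜 hξ γ (basisFun 𝕜 ξ β) = basisFun 𝕜 ξ β := by
  classical
  ext x
  rw [proj_apply, basisFun_apply hξ, basisFun_apply hξ, isRecord_retr_iff hξ h]

theorem proj_basisFun_of_lt (hξ : ξ (isoZero (kap η)) = isoZero η)
    {β : Iso (kap η)} {γ : Ordinal.{u}} (h : γ < β) :
    proj 𝕜 hξ γ (basisFun 𝕜 ξ β) = 0 := by
  ext x
  rw [proj_apply, ContinuousMap.zero_apply, basisFun_apply_eq_zero hξ]
  exact not_isRecord_retr hξ h

theorem basisMeas_zero_apply (f : C(Seg η, 𝕜)) {α : Iso (kap η)} (h : (α : Ordinal.{u}) = 0) :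
    basisMeas 𝕜 ξ α f = f ⟨0, Set.mem_Iic.2 zero_le⟩ := by
  rw [basisMeas, if_pos h]; rfl

theorem basisMeas_apply (hξ : ξ (isoZero (kap η)) = isoZero η) (f : C(Seg η, 𝕜))
    {α : Iso (kap η)} (h : (α : Ordinal.{u}) ≠ 0) :
    basisMeas 𝕜 ξ α f = f (pt ξ α) - f (retr (setA ξ (prd α)) (pt ξ α)) := by
  rw [basisMeas, if_neg h, ← pMax_eq_retr (xi_notMem_setA_prd hξ h)]; rfl

/-- Where `α` is a record, `r_{A_α}(x) = ξ(α)`, and `x` and `ξ(α)` have the same image under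
`r_{A_{α-1}}`. Elsewhere either `ξ(α) > x`, or an earlier point in `[ξ(α), x]` makes `ξ(α)`
irrelevant, and the two retractions agree. -/
theorem proj_sub_proj_prd (hξ : ξ (isoZero (kap η)) = isoZero η)
    {α : Iso (kap η)} (h0 : (α : Ordinal.{u}) ≠ 0) (f : C(Seg η, 𝕜)) :
    proj 𝕜 hξ α f - proj 𝕜 hξ (prd α) f = basisMeas 𝕜 ξ α f • basisFun 𝕜 ξ α := by
  classical
  ext x
  rw [ContinuousMap.sub_apply, ContinuousMap.smul_apply, basisFun_apply hξ, proj_apply, proj_apply,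
    basisMeas_apply hξ f h0]
  split_ifs with h
  · have e1 : retr (setA ξ α) x = pt ξ α := by
      refine Subtype.ext (le_antisymm (not_lt.1 fun hlt => ?_) (xi_le_retr hξ le_rfl h.1))
      obtain ⟨β, h1, h2, h3⟩ := (lt_retr_iff hξ).1 hlt
      rcases h1.lt_or_eq with h1 | h1
      · exact (h.2 β h1 h3).not_gt h2
      · rw [Subtype.ext h1] at h2
        exact lt_irrefl _ h2
    have e2 : retr (setA ξ (prd α)) x = retr (setA ξ (prd α)) (pt ξ α) := by
      refine Subtype.ext (eq_of_forall_lt_iff fun b => ?_)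
      rw [lt_retr_iff hξ, lt_retr_iff hξ]
      refine exists_congr fun β => and_congr_right fun hβ => and_congr_right fun _ => ?_
      exact ⟨fun h' => (h.2 β ((le_prd_iff h0).1 hβ) h').le, fun h' => le_trans h' h.1⟩
    rw [e1, e2, smul_eq_mul, mul_one]
  · have e : retr (setA ξ α) x = retr (setA ξ (prd α)) x := by
      refine Subtype.ext (eq_of_forall_lt_iff fun b => ?_)
      rw [lt_retr_iff hξ, lt_retr_iff hξ]
      constructor
      · rintro ⟨β, h1, h2, h3⟩
        rcases h1.lt_or_eq with h1 | h1
        · exact ⟨β, (le_prd_iff h0).2 h1, h2, h3⟩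
        · obtain rfl : β = α := Subtype.ext h1
          have : ∃ β' : Iso (kap η), (β' : Ordinal.{u}) < β ∧ (ξ β' : Ordinal.{u}) ≤ x ∧
              (ξ β : Ordinal.{u}) ≤ ξ β' := by
            by_contra! hc
            exact h ⟨h3, hc⟩
          obtain ⟨β', h4, h5, h6⟩ := this
          exact ⟨β', (le_prd_iff h0).2 h4, h2.trans_le h6, h5⟩
      · rintro ⟨β, h1, h2, h3⟩
        exact ⟨β, ((le_prd_iff h0).1 h1).le, h2, h3⟩
    rw [e, sub_self, smul_zero]

theorem proj_zero_apply (hξ : ξ (isoZero (kap η)) = isoZero η) (f : C(Seg η, 𝕜)) : proj 𝕜 hξ 0 f =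
    basisMeas 𝕜 ξ (isoZero (kap η)) f • basisFun 𝕜 ξ (isoZero (kap η)) := by
  have h0 : ((isoZero (kap η) : Iso (kap η)) : Ordinal.{u}) = 0 := rfl
  ext x
  rw [basisMeas_zero_apply f h0, basisFun, if_pos h0]
  simp only [proj_apply, ContinuousMap.smul_apply, ContinuousMap.one_apply, smul_eq_mul, mul_one]
  congr 1
  refine Subtype.ext (le_antisymm (not_lt.1 fun hlt => ?_) zero_le)
  obtain ⟨β, h1, h2, h3⟩ := (lt_retr_iff hξ).1 hlt
  have := (xi_eq_zero_iff hξ).2 (le_antisymm h1 zero_le)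
  exact h2.ne' this

theorem basisFun_pt (hξ : ξ (isoZero (kap η)) = isoZero η)
    (α : Iso (kap η)) : basisFun 𝕜 ξ α (pt ξ α) = 1 :=
  (basisFun_apply_eq_one hξ).2 (isRecord_self α)

theorem basisFun_ne_zero (hξ : ξ (isoZero (kap η)) = isoZero η)
    (α : Iso (kap η)) : basisFun 𝕜 ξ α ≠ 0 := fun h => by
  have := basisFun_pt (𝕜 := 𝕜) hξ α
  rw [h] at this
  exact zero_ne_one this

theorem basisMeas_basisFun_self (hξ : ξ (isoZero (kap η)) = isoZero η)
    (α : Iso (kap η)) : basisMeas 𝕜 ξ α (basisFun 𝕜 ξ α) = 1 := by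
  by_cases h0 : (α : Ordinal.{u}) = 0
  · rw [basisMeas_zero_apply _ h0, basisFun, if_pos h0]; rfl
  · rw [basisMeas_apply hξ _ h0, basisFun_pt hξ,
      (basisFun_apply_eq_zero hξ).2 (not_isRecord_retr hξ ((le_prd_iff h0).1 le_rfl)), sub_zero]

theorem basisMeas_basisFun_of_ne (hξ : ξ (isoZero (kap η)) = isoZero η)
    {α β : Iso (kap η)} (h : α ≠ β) :
    basisMeas 𝕜 ξ α (basisFun 𝕜 ξ β) = 0 := by
  by_cases h0 : (α : Ordinal.{u}) = 0
  · rw [basisMeas_zero_apply _ h0, basisFun_apply_eq_zero hξ]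
    intro hr
    have := (xi_eq_zero_iff hξ).1 (le_antisymm hr.1 zero_le)
    exact h (Subtype.ext (h0.trans this.symm))
  · have h1 := congrArg (fun g => g (pt ξ α)) (proj_sub_proj_prd (𝕜 := 𝕜) hξ h0 (basisFun 𝕜 ξ β))
    -- For `β ≠ α` both sides are `f_β` or both are `0`, so `μ_α(f_β) f_α = 0`; evaluate at `ξ(α)`.
    have h2 : proj 𝕜 hξ α (basisFun 𝕜 ξ β) = proj 𝕜 hξ (prd α) (basisFun 𝕜 ξ β) := by
      rcases lt_or_gt_of_ne (fun e => h (Subtype.ext e) : (α : Ordinal.{u}) ≠ β) with hlt | hlt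
      · rw [proj_basisFun_of_lt hξ hlt,
          proj_basisFun_of_lt hξ (((le_prd_iff h0).1 le_rfl).trans hlt)]
      · rw [proj_basisFun_of_le hξ hlt.le, proj_basisFun_of_le hξ ((le_prd_iff h0).2 hlt)]
    simpa [h2, basisFun_pt hξ] using h1.symm

theorem basisFun_injective (hξ : ξ (isoZero (kap η)) = isoZero η)
    : Function.Injective (basisFun 𝕜 ξ) := fun α β h => by
  by_contra hne
  have := basisMeas_basisFun_of_ne (𝕜 := 𝕜) hξ hne
  rw [← h, basisMeas_basisFun_self hξ] at this
  exact one_ne_zero this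

/-- Transfinite induction: an isolated stage adds only `μ_α(f) f_α`, a limit stage is a norm limit.
Keeping just the indices with nonzero coefficient is what makes the basis strong. -/
theorem proj_mem_closure_span (hξ : ξ (isoZero (kap η)) = isoZero η)
    (f : C(Seg η, 𝕜)) (γ : Ordinal.{u}) (hγ : γ ≤ kap η) :
    proj 𝕜 hξ γ f ∈ (Submodule.span 𝕜 (basisFun 𝕜 ξ ''
      {β | basisMeas 𝕜 ξ β f ≠ 0 ∧ (β : Ordinal.{u}) ≤ γ})).topologicalClosure := by
  have hterm : ∀ (γ : Ordinal.{u}) (α : Iso (kap η)), (α : Ordinal.{u}) ≤ γ →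
      basisMeas 𝕜 ξ α f • basisFun 𝕜 ξ α ∈ Submodule.span 𝕜 (basisFun 𝕜 ξ ''
      {β | basisMeas 𝕜 ξ β f ≠ 0 ∧ (β : Ordinal.{u}) ≤ γ}) := by
    intro γ α hα
    by_cases h : basisMeas 𝕜 ξ α f = 0
    · rw [h, zero_smul]; exact zero_mem _
    · exact Submodule.smul_mem _ _ (Submodule.subset_span ⟨α, ⟨h, hα⟩, rfl⟩)
  have hmono : ∀ γ δ : Ordinal.{u}, γ ≤ δ → (Submodule.span 𝕜 (basisFun 𝕜 ξ ''
      {β | basisMeas 𝕜 ξ β f ≠ 0 ∧ (β : Ordinal.{u}) ≤ γ})).topologicalClosure ≤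
      (Submodule.span 𝕜 (basisFun 𝕜 ξ ''
      {β | basisMeas 𝕜 ξ β f ≠ 0 ∧ (β : Ordinal.{u}) ≤ δ})).topologicalClosure := fun γ δ h =>
    Submodule.topologicalClosure_mono (Submodule.span_mono
      (image_mono fun β hβ => ⟨hβ.1, hβ.2.trans h⟩))
  induction γ using WellFoundedLT.induction with
  | ind γ ih =>
    by_cases hl : Order.IsSuccLimit γ
    · refine Metric.mem_closure_iff.2 fun ε hε => ?_
      obtain ⟨α, hα, h⟩ := proj_approx (hξ := hξ) hl f (half_pos hε)
      obtain ⟨g, hg, hdist⟩ := Metric.mem_closure_iff.1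
        (hmono _ _ hα.le (ih α hα (hα.le.trans hγ))) _ (half_pos hε)
      refine ⟨g, hg, ?_⟩
      have h1 := h α le_rfl hα.le
      rw [← dist_eq_norm] at h1
      calc _ ≤ _ + _ := dist_triangle_left _ _ (proj 𝕜 hξ α f)
        _ < ε := by linarith
    · let α : Iso (kap η) := ⟨γ, hγ, hl⟩
      by_cases h0 : γ = 0
      · subst h0
        rw [proj_zero_apply hξ]
        exact Submodule.le_topologicalClosure _ (hterm _ _ le_rfl)
      · have := proj_sub_proj_prd hξ (α := α) h0 f
        have e : proj 𝕜 hξ γ f = proj 𝕜 hξ (prd α) f + basisMeas 𝕜 ξ α f • basisFun 𝕜 ξ α := by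
          rw [← this]; simp [α]
        have hlt : prd α < γ := (le_prd_iff (α := α) h0).1 le_rfl
        rw [e]
        exact Submodule.add_mem _ (hmono _ _ hlt.le (ih _ hlt (hlt.le.trans hγ)))
          (Submodule.le_topologicalClosure _ (hterm _ _ le_rfl))

theorem mem_closure_span_basisFun (hξ : ξ (isoZero (kap η)) = isoZero η) (f : C(Seg η, 𝕜)) :
    f ∈ closure (Submodule.span 𝕜 (basisFun 𝕜 ξ '' {β | basisMeas 𝕜 ξ β f ≠ 0}) :
      Set C(Seg η, 𝕜)) := by
  have := proj_mem_closure_span hξ f (kap η) le_rfl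
  rw [proj_kap] at this
  exact closure_mono (Submodule.span_mono (image_mono fun β hβ => hβ.1)) this

/-- Strongness applied to `f - g`, which lies in the closed span of the empty set. -/
theorem eq_of_basisMeas_eq (hξ : ξ (isoZero (kap η)) = isoZero η) {f g : C(Seg η, 𝕜)}
    (h : ∀ α, basisMeas 𝕜 ξ α f = basisMeas 𝕜 ξ α g) : f = g := by
  have := mem_closure_span_basisFun hξ (f - g)
  simpa [h, sub_eq_zero] using this

theorem span_basisFun_dense (hξ : ξ (isoZero (kap η)) = isoZero η) :
    closure (Submodule.span 𝕜 (range (basisFun 𝕜 ξ)) : Set C(Seg η, 𝕜)) = Set.univ :=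
  Set.eq_univ_of_forall fun f =>
    closure_mono (Submodule.span_mono (image_subset_range _ _)) (mem_closure_span_basisFun hξ f)

theorem isStrongMarkushevichBasis (hξ : ξ (isoZero (kap η)) = isoZero η) :
    IsStrongMarkushevichBasis (basisFun 𝕜 ξ) (basisMeas 𝕜 ξ) :=
  ⟨⟨basisMeas_basisFun_self hξ, fun _ _ h => basisMeas_basisFun_of_ne hξ h, span_basisFun_dense hξ,
    fun _ _ h => eq_of_basisMeas_eq hξ h⟩, mem_closure_span_basisFun hξ⟩

/-- Functionals that agree on all `f_α` are equal. -/
theorem dual_ext (hξ : ξ (isoZero (kap η)) = isoZero η) {φ ψ : StrongDual 𝕜 C(Seg η, 𝕜)}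
    (h : ∀ α, φ (basisFun 𝕜 ξ α) = ψ (basisFun 𝕜 ξ α)) : φ = ψ := by
  refine ContinuousLinearMap.ext_on (s := range (basisFun 𝕜 ξ)) ?_ ?_
  · exact dense_iff_closure_eq.2 (span_basisFun_dense hξ)
  · rintro _ ⟨α, rfl⟩
    exact h α

end Basis

end OrdinalSegment

/-! ### Density character of a closed span -/

namespace BanachBasis

universe v

section DensChar

variable {𝕜 : Type} [RCLike 𝕜] {X : Type v} [NormedAddCommGroup X] [NormedSpace 𝕜 X]

theorem densChar_le {Y : Type v} [TopologicalSpace Y] {s t : Set Y} (hts : t ⊆ s)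
    (hst : s ⊆ closure t) : densChar s ≤ #t := csInf_le' ⟨t, hts, hst, rfl⟩

/-- A subspace in which the span of a family is dense has density character at most the
cardinality of the family (or `ℵ₀`). -/
theorem densChar_le_of_span {ι : Type v} (g : ι → X) {s : Set X}
    (h1 : (Submodule.span 𝕜 (range g) : Set X) ⊆ s)
    (h2 : s ⊆ closure (Submodule.span 𝕜 (range g) : Set X)) : densChar s ≤ max ℵ₀ #ι := by
  obtain ⟨Q, hQc, hQd⟩ := TopologicalSpace.exists_countable_dense 𝕜
  -- Finite combinations with coefficients in a countable dense set of scalars: at most `max ℵ₀ #ι`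
  -- of them, and their closure contains the span.
  let L : List (Q × ι) → X := fun l => (l.map fun p => (p.1 : 𝕜) • g p.2).sum
  have hadd : ∀ x ∈ closure (range L), ∀ y ∈ closure (range L), x + y ∈ closure (range L) := by
    intro x hx y hy
    refine map_mem_closure₂ continuous_add hx hy ?_
    rintro _ ⟨l, rfl⟩ _ ⟨l', rfl⟩
    exact ⟨l ++ l', by simp [L]⟩
  have hsmul : ∀ (c : 𝕜) (i : ι), c • g i ∈ closure (range L) := by
    intro c i
    refine map_mem_closure (f := fun c : 𝕜 => c • g i) (by fun_prop) (hQd c) ?_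
    intro q hq
    exact ⟨[(⟨q, hq⟩, i)], by simp [L]⟩
  have hspan : (Submodule.span 𝕜 (range g) : Set X) ⊆ closure (range L) := by
    intro x hx
    induction hx using Submodule.closure_induction with
    | zero => exact subset_closure ⟨[], by simp [L]⟩
    | add x y _ _ hx hy => exact hadd x hx y hy
    | smul_mem c x hx => obtain ⟨i, rfl⟩ := hx; exact hsmul c i
  have hL : range L ⊆ s := by
    rintro _ ⟨l, rfl⟩
    have : L l ∈ Submodule.span 𝕜 (range g) := by
      apply list_sum_mem
      intro x hx
      obtain ⟨p, -, rfl⟩ := List.mem_map.1 hx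
      exact Submodule.smul_mem _ _ (Submodule.subset_span ⟨p.2, rfl⟩)
    exact h1 this
  have hcard : #(range L) ≤ max ℵ₀ #ι := by
    refine mk_range_le.trans ((mk_list_le_max _).trans (max_le (le_max_left _ _) ?_))
    rw [mk_prod]
    refine (mul_le_max _ _).trans (max_le (max_le ?_ ?_) (le_max_left _ _))
    · exact le_trans (by simpa using hQc.le_aleph0) (le_max_left _ _)
    · simp
  refine (densChar_le hL ?_).trans hcard
  exact h2.trans (closure_minimal hspan isClosed_closure)

end DensChar

end BanachBasis

/-! ### The projectional resolution of the identity -/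

namespace OrdinalSegment

section Resolution

variable {𝕜 : Type} [RCLike 𝕜] {η : Ordinal.{u}} {ξ : Iso (kap η) ≃ Iso η}

theorem densChar_range_proj_le (hξ : ξ (isoZero (kap η)) = isoZero η) {α : Ordinal.{u}}
    (hα : α ≤ kap η) :
    densChar (range (proj 𝕜 hξ α)) ≤ max ℵ₀ (Cardinal.lift.{u + 1} α.card) := by
  let g : {β : Iso (kap η) // (β : Ordinal.{u}) ≤ α} → C(Seg η, 𝕜) := fun β => basisFun 𝕜 ξ β
  have h1 : (Submodule.span 𝕜 (range g) : Set C(Seg η, 𝕜)) ⊆ range (proj 𝕜 hξ α) := by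
    have : Submodule.span 𝕜 (range g) ≤ (proj 𝕜 hξ α).range := by
      rw [Submodule.span_le]
      rintro _ ⟨β, rfl⟩
      exact ⟨g β, proj_basisFun_of_le hξ β.2⟩
    exact this
  have h2 : range (proj 𝕜 hξ α) ⊆ closure (Submodule.span 𝕜 (range g) : Set C(Seg η, 𝕜)) := by
    rintro _ ⟨f, rfl⟩
    refine closure_mono (Submodule.span_mono ?_) (proj_mem_closure_span hξ f α hα)
    rintro _ ⟨β, hβ, rfl⟩
    exact ⟨⟨β, hβ.2⟩, rfl⟩
  refine (densChar_le_of_span g h1 h2).trans (max_le (le_max_left _ _) ?_)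
  have hinj : Function.Injective (fun β : {β : Iso (kap η) // (β : Ordinal.{u}) ≤ α} =>
      (⟨β.1.1, Order.lt_succ_iff.2 β.2⟩ : Iio (Order.succ α))) := by
    intro β γ h
    exact Subtype.ext (Subtype.ext (congrArg (fun x : Iio (Order.succ α) => x.1) h))
  refine (mk_le_of_injective hinj).trans ?_
  rw [Cardinal.mk_Iio_ordinal, Order.succ_eq_add_one, Ordinal.card_add_one, lift_add, lift_one]
  refine (add_le_max _ _).trans (max_le (max_le (le_max_right _ _) ?_) (le_max_left _ _))
  exact one_le_aleph0.trans (le_max_left _ _)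

/-- The functions `χ_[0,b]`, `b < η`, are at mutual distance at least `1`, so their approximants
within `1/2` in a dense set are distinct. -/
theorem le_densChar_univ :
    Cardinal.lift.{u + 1} η.card ≤ densChar (Set.univ : Set C(Seg η, 𝕜)) := by
  refine le_csInf ⟨_, Set.univ, subset_rfl, subset_closure, rfl⟩ ?_
  rintro _ ⟨t, -, ht, rfl⟩
  have hex : ∀ b : Iio η, ∃ g ∈ t, dist (step 𝕜 (b : Ordinal.{u})) g < 1 / 2 := fun b =>
    Metric.mem_closure_iff.1 (ht (mem_univ _)) _ one_half_pos
  choose g hgt hg using hex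
  rw [← Cardinal.mk_Iio_ordinal]
  refine mk_le_of_injective (f := fun b => (⟨g b, hgt b⟩ : t)) ?_
  have key : ∀ a b : Iio η, (a : Ordinal.{u}) < b → g a ≠ g b := by
    intro a b hab h
    have h1 : dist (step 𝕜 (a : Ordinal.{u}) : C(Seg η, 𝕜)) (step 𝕜 (b : Ordinal.{u})) < 1 := by
      calc _ ≤ _ + _ := dist_triangle_right _ _ (g a)
        _ < 1 / 2 + 1 / 2 := add_lt_add (hg a) (h ▸ hg b)
        _ = 1 := by norm_num
    have h2 := (ContinuousMap.dist_apply_le_dist ⟨b, Set.mem_Iic.2 (Set.mem_Iio.1 b.2).le⟩).trans_lt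
      h1
    simp [step_apply, hab.not_ge, dist_eq_norm] at h2
  intro a b h
  have h' : g a = g b := congrArg Subtype.val h
  rcases lt_trichotomy (a : Ordinal.{u}) b with hab | hab | hab
  · exact absurd h' (key a b hab)
  · exact Subtype.ext hab
  · exact absurd h'.symm (key b a hab)

theorem norm_proj (hξ : ξ (isoZero (kap η)) = isoZero η) (α : Ordinal.{u}) :
    ‖proj 𝕜 hξ α‖ = 1 := by
  refine le_antisymm (ContinuousLinearMap.opNorm_le_bound _ zero_le_one fun f => ?_) ?_
  · rw [one_mul]; exact norm_proj_apply_le α f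
  · have h1 : proj 𝕜 hξ α 1 = 1 := by ext; simp
    have h2 : ‖(1 : C(Seg η, 𝕜))‖ ≤ 1 := (ContinuousMap.norm_le _ zero_le_one).2 fun x => by simp
    have h3 : 1 ≤ ‖(1 : C(Seg η, 𝕜))‖ := by
      simpa only [ContinuousMap.one_apply, norm_one] using
        (1 : C(Seg η, 𝕜)).norm_coe_le_norm ⟨0, Set.mem_Iic.2 zero_le⟩
    have h4 := (proj 𝕜 hξ α).le_opNorm 1
    rwa [h1, le_antisymm h2 h3, mul_one] at h4

open Classical in
theorem isPRI_proj (hξ : ξ (isoZero (kap η)) = isoZero η) (hη : Ordinal.omega0 ≤ η) :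
    IsPRI (kap η) (Function.update (proj 𝕜 hξ) 0 0) := by
  have hne : kap η ≠ 0 := (kap_isSuccLimit hη).bot_lt.ne'
  have hηc : ℵ₀ ≤ η.card := by simpa using Ordinal.card_le_card hη
  have hid : ∀ c : Cardinal.{u + 1}, Cardinal.lift.{u} c = c := fun c =>
    Cardinal.lift_id'.{u, u + 1} c
  have hupd : ∀ α ≠ 0, Function.update (proj 𝕜 hξ) 0 0 α = proj 𝕜 hξ α := fun α h =>
    Function.update_of_ne h _ _
  have hdens : ∀ α ≤ kap η, Cardinal.lift.{u} (densChar (range (Function.update (proj 𝕜 hξ) 0 0 α)))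
      ≤ Cardinal.lift.{u + 1} (max ℵ₀ α.card) := by
    intro α hα
    rw [hid, lift_max, lift_aleph0]
    rcases eq_or_ne α 0 with rfl | h
    · refine (densChar_le (t := {0}) ?_ ?_).trans ?_
      · simp
      · rw [Function.update_self]
        rintro _ ⟨f, rfl⟩
        exact subset_closure rfl
      · rw [mk_singleton]; exact one_le_aleph0.trans (le_max_left _ _)
    · rw [hupd α h]
      exact densChar_range_proj_le hξ hα
  refine ⟨by simp [kap], le_antisymm ?_ ?_, Function.update_self _ _ _, ?_, ?_, hdens, ?_, ?_⟩
  · have := hdens (kap η) le_rfl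
    rw [hupd _ hne, proj_kap, max_eq_right (by simpa [kap] using hηc)] at this
    simpa using this
  · rw [hid]
    simpa [kap] using le_densChar_univ (𝕜 := 𝕜) (η := η)
  · rw [hupd _ hne, proj_kap]
  · intro α hα _
    rw [hupd _ hα.ne', norm_proj]
  · intro α β h _
    rcases eq_or_ne α 0 with rfl | h0
    · simp
    · rw [hupd _ h0, hupd _ (fun e => h0 (le_antisymm (e ▸ h) zero_le))]
      exact proj_mul h
  · intro l _ hlim
    rw [hupd _ hlim.bot_lt.ne', range_proj_limit hlim]
    refine Subset.antisymm (closure_mono ?_) (closure_mono ?_)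
    · simp only [iUnion_subset_iff]
      intro α hα
      -- Replacing `P_0` by `0` loses nothing below a limit: the range of `P_α` is contained in that
      -- of `P_{α+1}`, whose index is nonzero.
      have h1 : Order.succ α < l := hlim.succ_lt hα
      refine (range_proj_mono (Order.le_succ α)).trans ?_
      rw [← hupd _ (Order.succ_ne_bot α)]
      exact subset_iUnion₂_of_subset _ h1 subset_rfl
    · simp only [iUnion_subset_iff]
      intro α hα
      rcases eq_or_ne α 0 with rfl | h0
      · rw [Function.update_self]
        rintro _ ⟨f, rfl⟩
        exact mem_iUnion₂.2 ⟨0, hα, 0, map_zero _⟩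
      · rw [hupd _ h0]
        exact subset_iUnion₂_of_subset _ hα subset_rfl

end Resolution

end OrdinalSegment

namespace OrdinalSegment

/-! ### Functionals on `C([0, η])` are atomic measures -/

section Measures

variable {𝕜 : Type} [RCLike 𝕜] {η : Ordinal.{u}}

theorem step_mul_step {a b : Ordinal.{u}} (h : a ≤ b) :
    (step 𝕜 b * step 𝕜 a : C(Seg η, 𝕜)) = step 𝕜 a := by
  ext x
  simp only [ContinuousMap.mul_apply, step_apply]
  split_ifs with h1 h2 h2
  · simp
  · simp
  · exact absurd (h2.trans h) h1
  · simp

/-- The norm of the functional `φ` restricted to `[0, b]`. -/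
noncomputable def restrNorm (φ : StrongDual 𝕜 C(Seg η, 𝕜)) (b : Ordinal.{u}) : ℝ :=
  ‖φ.comp (ContinuousLinearMap.mul 𝕜 C(Seg η, 𝕜) (step 𝕜 b))‖

theorem le_restrNorm (φ : StrongDual 𝕜 C(Seg η, 𝕜)) (b : Ordinal.{u}) (f : C(Seg η, 𝕜)) :
    ‖φ (step 𝕜 b * f)‖ ≤ restrNorm φ b * ‖f‖ :=
  (φ.comp (ContinuousLinearMap.mul 𝕜 C(Seg η, 𝕜) (step 𝕜 b))).le_opNorm f

/-- The total variation is superadditive: a function cut to `[0, a]` and a multiple of `χ_(a,b]`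
have disjoint supports, so unimodular factors align the two values of `φ` without increasing the
supremum norm. -/
theorem restrNorm_add_le (φ : StrongDual 𝕜 C(Seg η, 𝕜)) {a b : Ordinal.{u}} (hab : a ≤ b) :
    restrNorm φ a + ‖φ (step 𝕜 b) - φ (step 𝕜 a)‖ ≤ restrNorm φ b := by
  have key : ∀ f : C(Seg η, 𝕜), ‖φ (step 𝕜 a * f)‖ + ‖φ (step 𝕜 b) - φ (step 𝕜 a)‖ * ‖f‖ ≤
      restrNorm φ b * ‖f‖ := by
    intro f
    obtain ⟨u, hu, hu'⟩ := RCLike.exists_norm_eq_mul_self (φ (step 𝕜 a * f))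
    obtain ⟨v, hv, hv'⟩ := RCLike.exists_norm_eq_mul_self (φ (step 𝕜 b) - φ (step 𝕜 a))
    -- The factor `‖f‖` makes both pieces of size at most `‖f‖`, so the estimate is homogeneous and
    -- bounds an operator norm.
    let g : C(Seg η, 𝕜) := u • (step 𝕜 a * f) + (v * (‖f‖ : 𝕜)) • (step 𝕜 b - step 𝕜 a)
    have hg : ‖g‖ ≤ ‖f‖ := by
      refine (ContinuousMap.norm_le _ (norm_nonneg f)).2 fun x => ?_
      have hfx := f.norm_coe_le_norm x
      rcases le_or_gt (x : Ordinal.{u}) a with h | h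
      · simpa [g, step_apply, h, h.trans hab, hu] using hfx
      · rcases le_or_gt (x : Ordinal.{u}) b with h' | h'
        · simp [g, step_apply, h.not_ge, h', hv]
        · simp [g, step_apply, h.not_ge, h'.not_ge]
    have hbg : step 𝕜 b * g = g := by
      simp only [g, mul_add, mul_smul_comm, mul_sub, step_mul_step hab, step_mul_step le_rfl,
        ← mul_assoc]
    have hφ : φ g = ((‖φ (step 𝕜 a * f)‖ + ‖φ (step 𝕜 b) - φ (step 𝕜 a)‖ * ‖f‖ : ℝ) : 𝕜) := by
      rw [RCLike.ofReal_add, RCLike.ofReal_mul, hu', hv']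
      simp only [g, map_add, map_smul, map_sub, smul_eq_mul]
      ring
    have := le_restrNorm φ b g
    rw [hbg, hφ, RCLike.norm_ofReal, abs_of_nonneg (by positivity)] at this
    exact this.trans (mul_le_mul_of_nonneg_left hg (norm_nonneg _))
  have h1 : 0 ≤ restrNorm φ b - ‖φ (step 𝕜 b) - φ (step 𝕜 a)‖ := by
    have h := key 1
    have h1 : ‖(1 : C(Seg η, 𝕜))‖ = 1 := by
      have : Nonempty (Seg η) := ⟨⟨0, Set.mem_Iic.2 zero_le⟩⟩
      exact norm_one
    rw [h1, mul_one, mul_one, mul_one] at h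
    linarith [norm_nonneg (φ (step 𝕜 a))]
  have h2 : restrNorm φ a ≤ restrNorm φ b - ‖φ (step 𝕜 b) - φ (step 𝕜 a)‖ := by
    refine ContinuousLinearMap.opNorm_le_bound _ h1 fun f => ?_
    have := key f
    simp only [ContinuousLinearMap.comp_apply, ContinuousLinearMap.mul_apply']
    linarith
  linarith

theorem restrNorm_mono (φ : StrongDual 𝕜 C(Seg η, 𝕜)) : Monotone (restrNorm φ) := fun a b h => by
  linarith [restrNorm_add_le φ h, norm_nonneg (φ (step 𝕜 b) - φ (step 𝕜 a))]

theorem norm_step_le (φ : StrongDual 𝕜 C(Seg η, 𝕜)) (b : Ordinal.{u}) :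
    ‖φ (step 𝕜 b)‖ ≤ restrNorm φ b := by
  have h := le_restrNorm φ b 1
  have : Nonempty (Seg η) := ⟨⟨0, Set.mem_Iic.2 zero_le⟩⟩
  rwa [norm_one, mul_one, mul_one] at h

/-- The mass of the point `x`. -/
theorem exists_pointMass (φ : StrongDual 𝕜 C(Seg η, 𝕜)) (x : Ordinal.{u}) :
    ∃ c : 𝕜, (x = 0 → c = φ (step 𝕜 0)) ∧ (x ≠ 0 →
      Tendsto (fun a : Iio x => φ (step 𝕜 x) - φ (step 𝕜 (a : Ordinal.{u}))) atTop (𝓝 c)) := by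
  rcases eq_or_ne x 0 with rfl | h0
  · exact ⟨φ (step 𝕜 0), by simp⟩
  have : Nonempty (Iio x) := ⟨⟨0, Set.mem_Iio.2 (pos_iff_ne_zero.2 h0)⟩⟩
  -- The oscillation of `φ(χ_[0,a])` is dominated by the growth of the bounded monotone function
  -- `restrNorm φ`.
  have hc : CauchySeq (fun a : Iio x => φ (step 𝕜 (a : Ordinal.{u}))) := by
    refine Metric.cauchySeq_iff'.2 fun ε hε => ?_
    have hb : BddAbove (range fun a : Iio x => restrNorm φ a) := by
      refine ⟨restrNorm φ x, ?_⟩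
      rintro _ ⟨a, rfl⟩
      exact restrNorm_mono φ (Set.mem_Iio.1 a.2).le
    obtain ⟨a, ha⟩ := exists_lt_of_lt_ciSup
      (sub_lt_self (⨆ a : Iio x, restrNorm φ (a : Ordinal.{u})) hε)
    refine ⟨a, fun n hn => ?_⟩
    have h1 := le_ciSup hb n
    have h2 := restrNorm_add_le φ (show (a : Ordinal.{u}) ≤ n from hn)
    rw [dist_eq_norm]
    linarith
  obtain ⟨l, hl⟩ := cauchySeq_tendsto_of_complete hc
  exact ⟨φ (step 𝕜 x) - l, fun h => absurd h h0, fun _ => tendsto_const_nhds.sub hl⟩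

theorem step_min (b : Ordinal.{u}) : (step 𝕜 b : C(Seg η, 𝕜)) = step 𝕜 (min b η) := by
  ext x
  have : (x : Ordinal.{u}) ≤ η := x.2
  simp [step_apply, this]

/-- The series `∑ c_x δ_x` converges absolutely in the dual, and its sum agrees with `φ` on the
linearly dense step functions. -/
theorem hasSum_of_step {φ : StrongDual 𝕜 C(Seg η, 𝕜)} {c : Seg η → 𝕜}
    (hc : Summable fun x => ‖c x‖) (h : ∀ b, φ (step 𝕜 b) = ∑' x : Seg η, c x * step 𝕜 b x)
    (f : C(Seg η, 𝕜)) : HasSum (fun x => c x * f x) (φ f) := by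
  have hs : Summable fun x : Seg η => c x • (dirac x : StrongDual 𝕜 C(Seg η, 𝕜)) := by
    refine Summable.of_norm_bounded hc fun x => ?_
    rw [norm_smul]
    refine mul_le_of_le_one_right (norm_nonneg _) ?_
    refine ContinuousLinearMap.opNorm_le_bound _ zero_le_one fun f => ?_
    rw [one_mul]
    exact f.norm_coe_le_norm x
  obtain ⟨ψ, hψ⟩ := hs
  have hψf : ∀ f : C(Seg η, 𝕜), HasSum (fun x : Seg η => c x * f x) (ψ f) := fun f => by
    have := hψ.mapL (ContinuousLinearMap.apply 𝕜 𝕜 f)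
    simp only [ContinuousLinearMap.apply_apply] at this
    exact this
  have heq : φ = ψ := by
    refine ContinuousLinearMap.ext_on (s := range fun b => (step 𝕜 b : C(Seg η, 𝕜)))
      (dense_iff_closure_eq.2 span_step_dense) ?_
    rintro _ ⟨b, rfl⟩
    exact (h b).trans (hψf _).tsum_eq
  rw [heq]
  exact hψf f

/-- Every functional on `C([0, η])` is an atomic measure. -/
theorem exists_hasSum (φ : StrongDual 𝕜 C(Seg η, 𝕜)) :
    ∃ c : Seg η → 𝕜, Summable (fun x => ‖c x‖) ∧
      (∀ f : C(Seg η, 𝕜), HasSum (fun x => c x * f x) (φ f)) ∧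
      ∀ x : Seg η, (∃ a < (x : Ordinal.{u}), ∀ a', a ≤ a' → a' < (x : Ordinal.{u}) →
        φ (step 𝕜 (x : Ordinal.{u})) = φ (step 𝕜 a')) → c x = 0 := by
  choose m hm0 hm using exists_pointMass φ
  have hmle : ∀ x, ∀ a < x, ‖m x‖ ≤ restrNorm φ x - restrNorm φ a := by
    intro x a ha
    have : Nonempty (Iio x) := ⟨⟨a, ha⟩⟩
    refine le_of_tendsto (hm x (ne_bot_of_gt ha)).norm ?_
    filter_upwards [eventually_ge_atTop (⟨a, ha⟩ : Iio x)] with b hb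
    have h1 := restrNorm_add_le φ (Set.mem_Iio.1 b.2).le
    have h2 := restrNorm_mono φ (show a ≤ (b : Ordinal.{u}) from hb)
    linarith
  -- Each mass is bounded by the growth of `restrNorm φ` up to its point, so sums over increasing
  -- points telescope.
  have hsum : ∀ s : Finset (Seg η), ∀ b : Ordinal.{u}, (∀ x ∈ s, (x : Ordinal.{u}) ≤ b) →
      ∑ x ∈ s, ‖m x‖ ≤ restrNorm φ b := by
    intro s
    induction s using Finset.induction_on_max with
    | empty =>
      intro b _
      rw [Finset.sum_empty]
      exact (norm_nonneg _).trans (norm_step_le φ b)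
    | insert x s hx ih =>
      intro b hb
      rw [Finset.sum_insert (fun h => lt_irrefl _ (hx x h))]
      have hxb := hb x (Finset.mem_insert_self _ _)
      rcases eq_or_ne (x : Ordinal.{u}) 0 with h0 | h0
      · have hs : s = ∅ := Finset.eq_empty_of_forall_notMem fun y hy => by
          have : (y : Ordinal.{u}) < x := hx y hy
          rw [h0] at this
          exact not_lt_zero this
        rw [hs, Finset.sum_empty, add_zero, hm0 _ h0]
        exact (norm_step_le φ 0).trans (restrNorm_mono φ zero_le)
      · have hy : s.sup (fun x => (x : Ordinal.{u})) < x :=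
          (Finset.sup_lt_iff (pos_iff_ne_zero.2 h0)).2 fun y hy => hx y hy
        have h1 := ih _ fun y hy => Finset.le_sup (f := fun x : Seg η => (x : Ordinal.{u})) hy
        have h2 := hmle x _ hy
        have h3 := restrNorm_mono φ hxb
        linarith
  have hsummable : Summable fun x : Seg η => ‖m x‖ :=
    summable_of_sum_le (fun _ => norm_nonneg _) fun s => hsum s η fun x _ => x.2
  have hsm : ∀ g : Seg η → 𝕜, (∀ x, ‖g x‖ ≤ 1) → Summable fun x : Seg η => m x * g x := by
    intro g hg
    refine Summable.of_norm_bounded hsummable fun x => ?_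
    rw [norm_mul]
    exact mul_le_of_le_one_right (norm_nonneg _) (hg x)
  have hst : ∀ b (x : Seg η), ‖(step 𝕜 b : C(Seg η, 𝕜)) x‖ ≤ 1 := by
    intro b x
    rw [step_apply]
    split_ifs <;> simp
  -- Transfinite induction: by dominated convergence the sums over `[0, a]` tend to the sum over
  -- `[0, b)` as `a → b`, and the remaining jump at `b` is the mass `m b` by its definition.
  have hF : ∀ b ≤ η, φ (step 𝕜 b) = ∑' x : Seg η, m x * step 𝕜 b x := by
    classical
    intro b
    induction b using WellFoundedLT.induction with
    | ind b ih =>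
      intro hb
      rcases eq_or_ne b 0 with rfl | h0
      · rw [tsum_eq_single ⟨0, hb⟩]
        · simp [step_apply, hm0]
        · intro x hx
          have : (x : Ordinal.{u}) ≠ 0 := fun h => hx (Subtype.ext h)
          simp [step_apply, this]
      · have : Nonempty (Iio b) := ⟨⟨0, Set.mem_Iio.2 (pos_iff_ne_zero.2 h0)⟩⟩
        let g : Seg η → 𝕜 := fun x => if (x : Ordinal.{u}) < b then 1 else 0
        have hg : ∀ x, ‖g x‖ ≤ 1 := by
          intro x
          simp only [g]
          split_ifs <;> simp
        have hlim : Tendsto (fun a : Iio b => ∑' x : Seg η, m x * step 𝕜 (a : Ordinal.{u}) x) atTop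
            (𝓝 (∑' x : Seg η, m x * g x)) := by
          refine tendsto_tsum_of_dominated_convergence hsummable (fun x => ?_) ?_
          · refine tendsto_const_nhds.congr' ?_
            rcases lt_or_ge (x : Ordinal.{u}) b with hx | hx
            · filter_upwards [eventually_ge_atTop (⟨x, hx⟩ : Iio b)] with a ha
              have : (x : Ordinal.{u}) ≤ a := ha
              simp [g, hx, step_apply, this]
            · filter_upwards with a
              have : ¬ (x : Ordinal.{u}) ≤ a := not_le.2 (lt_of_lt_of_le a.2 hx)
              simp [g, hx.not_gt, step_apply, this]
          · filter_upwards with a x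
            rw [norm_mul]
            exact mul_le_of_le_one_right (norm_nonneg _) (hst _ x)
        have hlim2 : Tendsto (fun a : Iio b => φ (step 𝕜 (a : Ordinal.{u}))) atTop
            (𝓝 (∑' x : Seg η, m x * g x)) :=
          hlim.congr fun a => (ih a a.2 ((Set.mem_Iio.1 a.2).le.trans hb)).symm
        have h1 := tendsto_nhds_unique (hm b h0) (tendsto_const_nhds.sub hlim2)
        have h2 : ∑' x : Seg η, m x * step 𝕜 b x = ∑' x : Seg η, m x * g x + m b := by
          have e : ∀ x : Seg η, m x * step 𝕜 b x =
              m x * g x + if x = ⟨b, hb⟩ then m b else 0 := by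
            intro x
            rcases lt_trichotomy (x : Ordinal.{u}) b with h | h | h
            · have : x ≠ ⟨b, hb⟩ := fun e => h.ne (congrArg Subtype.val e)
              simp [g, step_apply, h, h.le, this]
            · have : x = ⟨b, hb⟩ := Subtype.ext h
              simp [g, step_apply, this]
            · have : x ≠ ⟨b, hb⟩ := fun e => h.ne' (congrArg Subtype.val e)
              simp [g, step_apply, h.not_gt, h.not_ge, this]
          rw [tsum_congr e, Summable.tsum_add (hsm g hg) (hasSum_ite_eq _ _).summable, tsum_ite_eq]
        rw [h2, h1]
        ring
  refine ⟨fun x => m x, hsummable, ?_, ?_⟩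
  · refine hasSum_of_step hsummable fun b => ?_
    rw [step_min]
    exact hF _ (min_le_right _ _)
  · rintro x ⟨a, ha, h⟩
    have : Nonempty (Iio (x : Ordinal.{u})) := ⟨⟨a, ha⟩⟩
    refine tendsto_nhds_unique (hm x (ne_bot_of_gt ha)) (tendsto_const_nhds.congr' ?_)
    filter_upwards [eventually_ge_atTop (⟨a, ha⟩ : Iio (x : Ordinal.{u}))] with b hb
    rw [h b hb b.2, sub_self]

end Measures

end OrdinalSegment

/-! ### Images of the one-point lindelöfication, and continuity for `σ(X, D)` -/

namespace BanachBasis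

universe v

section Lindelof

theorem LindelofOne.continuous_of_countable {Γ : Type v} {Y : Type*} [TopologicalSpace Y]
    {g : LindelofOne Γ → Y} (h : {x | g x ≠ g LindelofOne.infty}.Countable) : Continuous g := by
  refine continuous_def.2 fun U _ => ?_
  intro hU
  refine h.mono ?_
  intro x hx hgx
  refine hx ?_
  change g x ∈ U
  rw [hgx]
  exact hU

theorem LindelofOne.isLindelof_univ (Γ : Type v) : IsLindelof (Set.univ : Set (LindelofOne Γ)) := by
  refine isLindelof_of_countable_subcover fun {ι} U hU hcov => ?_
  obtain ⟨i, hi⟩ := mem_iUnion.1 (hcov (mem_univ LindelofOne.infty))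
  have hc : (U i)ᶜ.Countable := hU i hi
  have hex : ∀ x : LindelofOne Γ, ∃ j, x ∈ U j := fun x => mem_iUnion.1 (hcov (mem_univ x))
  choose j hj using hex
  refine ⟨insert i (j '' (U i)ᶜ), (hc.image j).insert i, fun x _ => ?_⟩
  by_cases hx : x ∈ U i
  · exact mem_iUnion₂.2 ⟨i, mem_insert _ _, hx⟩
  · exact mem_iUnion₂.2 ⟨j x, mem_insert_of_mem _ ⟨x, hx, rfl⟩, hj x⟩

variable {Y : Type v} [TopologicalSpace Y] {Γ : Type v} {g : LindelofOne Γ → Y}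

theorem isLindelof_range_of_continuous (hg : Continuous g) : IsLindelof (range g) := by
  rw [← image_univ]
  exact (LindelofOne.isLindelof_univ Γ).image hg

/-- A single factor suffices: take the whole power and apply `g` to coordinate `0`. -/
theorem isPrimarilyLindelof_range (hg : Continuous g) : IsPrimarilyLindelof (range g) := by
  refine ⟨Γ, Set.univ, fun x => g (x 0), isClosed_univ,
    (hg.comp (continuous_apply 0)).continuousOn, ?_⟩
  ext y
  constructor
  · rintro ⟨x, -, rfl⟩
    exact ⟨_, rfl⟩
  · rintro ⟨x, rfl⟩
    exact ⟨fun _ => x, mem_univ _, rfl⟩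

end Lindelof

section SigmaTop

variable {𝕜 : Type} [RCLike 𝕜] {X : Type v} [NormedAddCommGroup X] [NormedSpace 𝕜 X]
  {D : Submodule 𝕜 (StrongDual 𝕜 X)}

theorem continuous_sigmaTop {φ : StrongDual 𝕜 X} (h : φ ∈ D) :
    Continuous[sigmaTop D, inferInstance] (fun x : X => φ x) :=
  continuous_iInf_dom (i := φ) (continuous_iInf_dom (i := h) continuous_induced_dom)

theorem continuous_to_sigmaTop {Z : Type*} [t : TopologicalSpace Z] {g : Z → X}
    (h : ∀ φ ∈ D, Continuous fun z => φ (g z)) : Continuous[t, sigmaTop D] g :=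
  continuous_iInf_rng.2 fun φ => continuous_iInf_rng.2 fun hφ => continuous_induced_rng.2 (h φ hφ)

end SigmaTop

end BanachBasis

namespace OrdinalSegment

/-! ### Countable cofinality -/

section Cofinality

theorem exists_bound_of_countable {x : Ordinal.{u}} (hx : ℵ₀ < x.cof) {s : Set Ordinal.{u}}
    (hs : s.Countable) (hsx : ∀ y ∈ s, y < x) : ∃ b < x, ∀ y ∈ s, y ≤ b := by
  refine ⟨sSup s, Ordinal.sSup_lt_of_lt_cof ?_ hsx,
    fun y hy => le_csSup ⟨x, fun z hz => (hsx z hz).le⟩ hy⟩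
  rw [← Ordinal.lift_cof]
  exact hs.le_aleph0.trans_lt (aleph0_lt_lift.2 hx)

theorem isSuccLimit_of_aleph0_lt_cof {x : Ordinal.{u}} (hx : ℵ₀ < x.cof) : Order.IsSuccLimit x :=
  Ordinal.one_lt_cof_iff.1 (one_lt_aleph0.trans hx)

theorem exists_countable_cofinal {x : Ordinal.{u}} (hx : ¬ ℵ₀ < x.cof) :
    ∃ s : Set Ordinal.{u}, s.Countable ∧ (∀ y ∈ s, y < x) ∧ ∀ b < x, ∃ y ∈ s, b ≤ y := by
  obtain ⟨s, hs, hc⟩ := Order.exists_cof_eq (Iio x)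
  refine ⟨Subtype.val '' s, Set.Countable.image ?_ _, ?_, fun b hb => ?_⟩
  · rw [← le_aleph0_iff_set_countable, hc, Ordinal.cof_Iio, ← Ordinal.lift_cof]
    exact lift_le_aleph0.2 (not_lt.1 hx)
  · rintro _ ⟨y, -, rfl⟩
    exact y.2
  · obtain ⟨y, hy, hby⟩ := hs ⟨b, hb⟩
    exact ⟨y, ⟨y, hy, rfl⟩, hby⟩

/-- Regularity of `ω_1`. -/
theorem card_sSup_le_aleph0 {s : Set Ordinal.{u}} (hs : s.Countable) (h : ∀ y ∈ s, y.card ≤ ℵ₀) :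
    (sSup s).card ≤ ℵ₀ := by
  have hlt : ∀ y : Ordinal.{u}, y < (ℵ_ 1).ord ↔ y.card ≤ ℵ₀ := by
    intro y
    rw [lt_ord, ← succ_aleph0, Order.lt_succ_iff]
  rw [← hlt]
  refine Ordinal.sSup_lt_of_lt_cof ?_ fun y hy => (hlt y).2 (h y hy)
  rw [← Ordinal.lift_cof, isRegular_aleph_one.cof_ord]
  refine hs.le_aleph0.trans_lt ?_
  exact aleph0_lt_lift.2 aleph0_lt_aleph_one

theorem countable_Iic_of_card_le {β : Ordinal.{u}} (h : β.card ≤ ℵ₀) : (Set.Iic β).Countable := by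
  rw [← Order.Iio_succ, ← le_aleph0_iff_set_countable, Cardinal.mk_Iio_ordinal,
    Order.succ_eq_add_one, Ordinal.card_add_one, lift_le_aleph0]
  exact add_le_aleph0.2 ⟨h, one_le_aleph0⟩

end Cofinality

/-! ### Membership in `D` as countable support on the basis -/

section CountableSupport

variable {𝕜 : Type} [RCLike 𝕜] {η : Ordinal.{u}} {ξ : Iso (kap η) ≃ Iso η}

theorem countable_le {κ β : Ordinal.{u}} (h : β.card ≤ ℵ₀) :
    {α : Iso κ | (α : Ordinal.{u}) ≤ β}.Countable :=
  (countable_Iic_of_card_le h).preimage Subtype.val_injective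

/-- A point of countable cofinality belongs to all `A_α` with `α` large, where largeness is decided
by countably many indices. -/
theorem exists_countable_mem_setA {x : Ordinal.{u}} (hxη : x ≤ η) (hx : ¬ ℵ₀ < x.cof) :
    ∃ B : Set (Iso (kap η)), B.Countable ∧
      ∀ α : Ordinal.{u}, (∀ β ∈ B, (β : Ordinal.{u}) ≤ α) → x ∈ setA ξ α := by
  by_cases hl : Order.IsSuccLimit x
  · obtain ⟨s, hs, hsx, hcof⟩ := exists_countable_cofinal hx
    refine ⟨range fun y : s => ξ.symm (isoSucc ((hsx y y.2).trans_le hxη)), ?_, fun α hα => ?_⟩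
    · have := hs.to_subtype
      exact countable_range _
    · refine mem_setA_of_forall hl.bot_lt.ne' fun b hb => ?_
      obtain ⟨y, hy, hby⟩ := hcof b hb
      refine ⟨_, hα _ ⟨⟨y, hy⟩, rfl⟩, ?_, ?_⟩
      · rw [Equiv.apply_symm_apply]
        exact hby.trans_lt (lt_add_one y)
      · rw [Equiv.apply_symm_apply]
        exact Order.add_one_le_of_lt (hsx y hy)
  · refine ⟨{ξ.symm ⟨x, hxη, hl⟩}, countable_singleton _, fun α hα => ?_⟩
    have := xi_mem_setA (ξ := ξ) (hα _ rfl)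
    rwa [Equiv.apply_symm_apply] at this

/-- The only direct use of `η < ω_2`: every index is below `κ ≤ ω_1`, hence countable. -/
theorem exists_countable_bound (hη : Ordinal.omega0 ≤ η) (h2 : η < Ordinal.omega 2)
    {B : Set (Iso (kap η))} (hB : B.Countable) :
    ∃ β ≤ kap η, β.card ≤ ℵ₀ ∧ ∀ b ∈ B, (b : Ordinal.{u}) ≤ β := by
  have hb : ∀ b ∈ Subtype.val '' B, b ≤ kap η := by
    rintro _ ⟨b, -, rfl⟩
    exact b.2.1
  refine ⟨sSup (Subtype.val '' B), csSup_le' hb, card_sSup_le_aleph0 (hB.image _) ?_,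
    fun b hb' => le_csSup ⟨_, hb⟩ ⟨b, hb', rfl⟩⟩
  rintro _ ⟨b, -, rfl⟩
  have h1 : (b : Ordinal.{u}).card < η.card := lt_ord.1 (iso_lt_kap hη b)
  have h3 : η.card < ℵ_ 2 := lt_omega_iff_card_lt.1 h2
  have h4 : (ℵ_ 2 : Cardinal.{u}) = Order.succ (ℵ_ 1) := by
    rw [succ_aleph, one_add_one_eq_two]
  rw [h4, Order.lt_succ_iff] at h3
  have h5 := h1.trans_le h3
  rwa [← succ_aleph0, Order.lt_succ_iff] at h5

/-- Countably many `ξ(γ)` below `x` are bounded below `x`, and none equals `x`, which is a limit. -/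
theorem notMem_setA_of_card_le {x β : Ordinal.{u}} (hx : ℵ₀ < x.cof) (hβ : β.card ≤ ℵ₀) :
    x ∉ setA ξ β := by
  intro h
  have hl := isSuccLimit_of_aleph0_lt_cof hx
  have hc : ({y | y < x} ∩ (fun γ : Iso (kap η) => (ξ γ : Ordinal.{u})) ''
      {γ | (γ : Ordinal.{u}) ≤ β}).Countable := ((countable_le hβ).image _).mono inter_subset_right
  obtain ⟨b, hb, hb'⟩ := exists_bound_of_countable hx hc fun y hy => hy.1
  obtain ⟨γ, h1, h2, h3⟩ := exists_xi_of_mem_setA h hb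
  have h4 : (ξ γ : Ordinal.{u}) < x := lt_of_le_of_ne h3 fun e => (ξ γ).2.2 (by rw [e]; exact hl)
  exact (hb' _ ⟨h4, γ, h1, rfl⟩).not_gt h2

/-- If `x` has uncountable cofinality, `A_β` misses some `(b, x]`, so `P_β` identifies `χ_[0,a]` and
`χ_[0,x]` for `b ≤ a < x`. Thus `φ(χ_[0,·])` has no jump at `x`, and the mass there is zero. -/
theorem mem_dualD_of_comp_proj (hξ : ξ (isoZero (kap η)) = isoZero η) {β : Ordinal.{u}}
    (hβ : β.card ≤ ℵ₀) {φ : StrongDual 𝕜 C(Seg η, 𝕜)} (hφ : φ = φ.comp (proj 𝕜 hξ β)) :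
    φ ∈ dualD 𝕜 η := by
  obtain ⟨c, hc, hsum, h0⟩ := exists_hasSum φ
  refine ⟨c, hc, fun x hx => h0 x ?_, hsum⟩
  have hxA : (x : Ordinal.{u}) ∉ setA ξ β := notMem_setA_of_card_le hx hβ
  have : ∃ b < (x : Ordinal.{u}), ∀ γ : Iso (kap η), (γ : Ordinal.{u}) ≤ β → b < ξ γ →
      ¬ (ξ γ : Ordinal.{u}) ≤ x := by
    by_contra! hcon
    exact hxA (mem_setA_of_forall (isSuccLimit_of_aleph0_lt_cof hx).bot_lt.ne' hcon)
  obtain ⟨b, hb, hb'⟩ := this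
  refine ⟨b, hb, fun a hba hax => ?_⟩
  rw [hφ]
  simp only [ContinuousLinearMap.comp_apply]
  congr 1
  ext y
  have key : (retr (setA ξ β) y : Ordinal.{u}) ≤ x ↔ (retr (setA ξ β) y : Ordinal.{u}) ≤ a := by
    refine ⟨fun h => not_lt.1 fun hlt => ?_, fun h => h.trans hax.le⟩
    obtain ⟨γ, h1, h2, h3⟩ := exists_xi_of_mem_setA (retr_isGreatest hξ β y).1.2 hlt
    exact hb' γ h1 (hba.trans_lt h2) (h3.trans h)
  simp only [proj_apply, step_apply, key]

theorem basisFun_apply_of_mem_setA (hξ : ξ (isoZero (kap η)) = isoZero η) {α : Iso (kap η)}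
    {β : Ordinal.{u}} (h : β < α) {x : Seg η} (hx : (x : Ordinal.{u}) ∈ setA ξ β) :
    basisFun 𝕜 ξ α x = 0 := by
  rw [basisFun_apply_eq_zero hξ, ← retr_eq_self hx]
  exact not_isRecord_retr hξ h

theorem comp_proj_of_countable (hξ : ξ (isoZero (kap η)) = isoZero η)
    (hη : Ordinal.omega0 ≤ η) (h2 : η < Ordinal.omega 2) {φ : StrongDual 𝕜 C(Seg η, 𝕜)}
    (h : {α : Iso (kap η) | φ (basisFun 𝕜 ξ α) ≠ 0}.Countable) :
    ∃ β ≤ kap η, β.card ≤ ℵ₀ ∧ φ = φ.comp (proj 𝕜 hξ β) := by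
  obtain ⟨β, hβκ, hβ, hb⟩ := exists_countable_bound hη h2 h
  refine ⟨β, hβκ, hβ, dual_ext hξ fun α => ?_⟩
  rw [ContinuousLinearMap.comp_apply]
  rcases le_or_gt (α : Ordinal.{u}) β with h | h
  · rw [proj_basisFun_of_le hξ h]
  · rw [proj_basisFun_of_lt hξ h, map_zero]
    by_contra hne
    exact (hb α hne).not_gt h

theorem countable_of_comp_proj (hξ : ξ (isoZero (kap η)) = isoZero η) {β : Ordinal.{u}}
    (hβ : β.card ≤ ℵ₀) (φ : StrongDual 𝕜 C(Seg η, 𝕜)) :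
    {α : Iso (kap η) | φ.comp (proj 𝕜 hξ β) (basisFun 𝕜 ξ α) ≠ 0}.Countable := by
  refine (countable_le hβ).mono fun α hα => (not_lt.1 fun h => hα ?_ : (α : Ordinal.{u}) ≤ β)
  rw [ContinuousLinearMap.comp_apply, proj_basisFun_of_lt hξ h, map_zero]

/-- For `φ ∈ D` some countable `β` puts the whole countable support of the measure into `A_β`, where
every `f_α` with `α > β` vanishes. Conversely, countability gives `φ = φ ∘ P_β`. -/
theorem mem_dualD_iff_countable (hξ : ξ (isoZero (kap η)) = isoZero η)
    (hη : Ordinal.omega0 ≤ η) (h2 : η < Ordinal.omega 2) (φ : StrongDual 𝕜 C(Seg η, 𝕜)) :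
    φ ∈ dualD 𝕜 η ↔ {α : Iso (kap η) | φ (basisFun 𝕜 ξ α) ≠ 0}.Countable := by
  constructor
  · rintro ⟨c, hc, hc0, hsum⟩
    have hN : (Function.support c).Countable := by
      simpa [Function.support] using hc.countable_support
    have hex : ∀ x : Seg η, ∃ B : Set (Iso (kap η)), B.Countable ∧ (c x ≠ 0 →
        ∀ α : Ordinal.{u}, (∀ β ∈ B, (β : Ordinal.{u}) ≤ α) → (x : Ordinal.{u}) ∈ setA ξ α) := by
      intro x
      by_cases hx : ℵ₀ < (x : Ordinal.{u}).cof
      · exact ⟨∅, countable_empty, fun h => absurd (hc0 x hx) h⟩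
      · obtain ⟨B, hB, h⟩ := exists_countable_mem_setA (ξ := ξ) x.2 hx
        exact ⟨B, hB, fun _ => h⟩
    choose B hBc hB using hex
    obtain ⟨β, -, hβ, hb⟩ := exists_countable_bound hη h2
      (hN.biUnion fun x _ => hBc x)
    refine (countable_le hβ).mono fun α hα => (not_lt.1 fun h => hα ?_ : (α : Ordinal.{u}) ≤ β)
    refine (hsum _).unique ?_
    convert hasSum_zero with x
    by_cases hx : c x = 0
    · rw [hx, zero_mul]
    · rw [basisFun_apply_of_mem_setA hξ h (hB x hx β fun b hb' =>
        hb b (mem_iUnion₂.2 ⟨x, hx, hb'⟩)), mul_zero]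
  · intro h
    obtain ⟨β, -, hβ, hφ⟩ := comp_proj_of_countable hξ hη h2 h
    exact mem_dualD_of_comp_proj hξ hβ hφ

/-- Each condition `ψ(f_α) = 0` is weak*-closed, so `φ` is supported in the union of countably many
countable supports. -/
theorem weakStarCountablyClosed_of_countable (hξ : ξ (isoZero (kap η)) = isoZero η)
    (hη : Ordinal.omega0 ≤ η) (h2 : η < Ordinal.omega 2) :
    WeakStarCountablyClosed (dualD 𝕜 η) := by
  intro C hC hCD φ hφ
  rw [mem_dualD_iff_countable hξ hη h2]
  have : (⋃ ψ ∈ C, {α : Iso (kap η) | ψ (basisFun 𝕜 ξ α) ≠ 0}).Countable :=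
    hC.biUnion fun ψ hψ => (mem_dualD_iff_countable hξ hη h2 ψ).1 (hCD hψ)
  refine this.mono fun α hα => ?_
  by_contra hcon
  refine hα ?_
  have hcl : IsClosed {ψ : WeakDual 𝕜 C(Seg η, 𝕜) | ψ (basisFun 𝕜 ξ α) = 0} :=
    isClosed_eq (WeakDual.eval_continuous _) continuous_const
  refine closure_minimal ?_ hcl hφ
  rintro _ ⟨ψ, hψ, rfl⟩
  by_contra hne
  exact hcon (mem_iUnion₂.2 ⟨ψ, hψ, hne⟩)

theorem basisMeas_mem_dualD_of_lt (hξ : ξ (isoZero (kap η)) = isoZero η)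
    (hη : Ordinal.omega0 ≤ η) (h2 : η < Ordinal.omega 2) (α : Iso (kap η)) :
    basisMeas 𝕜 ξ α ∈ dualD 𝕜 η := by
  rw [mem_dualD_iff_countable hξ hη h2]
  refine (countable_singleton α).mono fun β hβ => ?_
  by_contra hne
  exact hβ (basisMeas_basisFun_of_ne hξ (Ne.symm hne))

variable (𝕜 ξ) in
/-- The canonical map of the one-point lindelöfication of `I(κ)` onto `H`. -/
noncomputable def lindelofMap : LindelofOne (Iso (kap η)) → C(Seg η, 𝕜) :=
  fun x => Option.elim x 0 (basisFun 𝕜 ξ)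

theorem range_lindelofMap : range (lindelofMap 𝕜 ξ) = setH 𝕜 ξ := by
  ext g
  constructor
  · rintro ⟨x, rfl⟩
    rcases x with _ | α
    · exact Or.inr rfl
    · exact Or.inl ⟨α, rfl⟩
  · rintro (⟨α, rfl⟩ | h)
    · exact ⟨some α, rfl⟩
    · exact ⟨none, (Set.mem_singleton_iff.1 h).symm⟩

theorem continuous_lindelofMap (hξ : ξ (isoZero (kap η)) = isoZero η)
    (hη : Ordinal.omega0 ≤ η) (h2 : η < Ordinal.omega 2) :
    Continuous[inferInstance, sigmaTop (dualD 𝕜 η)] (lindelofMap 𝕜 ξ) := by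
  refine continuous_to_sigmaTop fun φ hφ => LindelofOne.continuous_of_countable ?_
  refine (((mem_dualD_iff_countable hξ hη h2 φ).1 hφ).image some).mono ?_
  intro x hx
  have h0 : φ (lindelofMap 𝕜 ξ LindelofOne.infty) = 0 := map_zero φ
  have hx' : φ (lindelofMap 𝕜 ξ x) ≠ 0 := fun e => hx (e.trans h0.symm)
  rcases x with _ | α
  · exact absurd (map_zero φ) hx'
  · exact ⟨α, hx', rfl⟩

/-- Stated for an arbitrary topology so that it can be used with `σ(C, D)`. -/
theorem isClosed_of_products {Y ι : Type*} [TopologicalSpace Y] {m : ι → Y → 𝕜}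
    (hm : ∀ i, Continuous (m i)) :
    IsClosed {g | (∀ i, m i g * (m i g - 1) = 0) ∧ ∀ i j, i ≠ j → m i g * m j g = 0} := by
  have : {g | (∀ i, m i g * (m i g - 1) = 0) ∧ ∀ i j, i ≠ j → m i g * m j g = 0} =
      (⋂ i, {g | m i g * (m i g - 1) = 0}) ∩ ⋂ i, ⋂ j, ⋂ _ : i ≠ j, {g | m i g * m j g = 0} := by
    ext g
    simp
  rw [this]
  refine (isClosed_iInter fun i => ?_).inter
    (isClosed_iInter fun i => isClosed_iInter fun j => isClosed_iInter fun _ => ?_)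
  · exact isClosed_eq ((hm i).mul ((hm i).sub continuous_const)) continuous_const
  · exact isClosed_eq ((hm i).mul (hm j)) continuous_const

/-- All coordinates are `0` or `1` and at most one is nonzero: closed conditions once the `μ_i` are
continuous. -/
theorem setH_eq (hξ : ξ (isoZero (kap η)) = isoZero η) :
    setH 𝕜 ξ = {g | (∀ i, basisMeas 𝕜 ξ i g * (basisMeas 𝕜 ξ i g - 1) = 0) ∧
      ∀ i j, i ≠ j → basisMeas 𝕜 ξ i g * basisMeas 𝕜 ξ j g = 0} := by
  classical
  have hμ : ∀ i j, basisMeas 𝕜 ξ i (basisFun 𝕜 ξ j) = if i = j then 1 else 0 := by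
    intro i j
    split_ifs with h
    · rw [h, basisMeas_basisFun_self hξ]
    · rw [basisMeas_basisFun_of_ne hξ h]
  ext g
  constructor
  · rintro (⟨α, rfl⟩ | h)
    · refine ⟨fun i => ?_, fun i j hij => ?_⟩
      · rw [hμ]; split_ifs <;> simp
      · rw [hμ, hμ]; split_ifs with h1 h2
        · exact absurd (h1.trans h2.symm) hij
        all_goals simp
    · rw [Set.mem_singleton_iff.1 h]
      simp
  · rintro ⟨h1, h2⟩
    by_cases h : ∃ α, basisMeas 𝕜 ξ α g ≠ 0
    · obtain ⟨α, hα⟩ := h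
      refine Or.inl ⟨α, eq_of_basisMeas_eq hξ fun β => ?_⟩
      rw [hμ]
      split_ifs with hβ
      · rw [hβ]
        exact (sub_eq_zero.1 ((mul_eq_zero.1 (h1 α)).resolve_left hα)).symm
      · exact ((mul_eq_zero.1 (h2 β α hβ)).resolve_right hα).symm
    · push Not at h
      exact Or.inr (eq_of_basisMeas_eq hξ fun β => by rw [h, map_zero])

/-- Assumes only `μ_α ∈ D`, not `η < ω_2`, so it also serves in (c). -/
theorem exists_isOpen_inter_setH (hξ : ξ (isoZero (kap η)) = isoZero η) {α : Iso (kap η)}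
    (hα : basisMeas 𝕜 ξ α ∈ dualD 𝕜 η) : IsOpen[sigmaTop (dualD 𝕜 η)] {g | basisMeas 𝕜 ξ α g ≠ 0} ∧
      {g | basisMeas 𝕜 ξ α g ≠ 0} ∩ setH 𝕜 ξ = {basisFun 𝕜 ξ α} := by
  refine ⟨@IsOpen.preimage _ _ (sigmaTop _) _ _ (continuous_sigmaTop hα) _
    isOpen_compl_singleton, ?_⟩
  ext g
  constructor
  · rintro ⟨h, ⟨β, rfl⟩ | h0⟩
    · by_cases hβ : α = β
      · rw [hβ]; rfl
      · exact absurd (basisMeas_basisFun_of_ne hξ hβ) h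
    · rw [Set.mem_singleton_iff.1 h0] at h
      exact absurd (map_zero _) h
  · intro h
    rw [Set.mem_singleton_iff.1 h]
    refine ⟨?_, Or.inl ⟨α, rfl⟩⟩
    rw [Set.mem_ofPred_eq, basisMeas_basisFun_self hξ]
    exact one_ne_zero

theorem isSigmaSubspaceOf (hξ : ξ (isoZero (kap η)) = isoZero η)
    (hη : Ordinal.omega0 ≤ η) (h2 : η < Ordinal.omega 2) :
    IsSigmaSubspaceOf (dualD 𝕜 η) (range (basisFun 𝕜 ξ)) := by
  refine ⟨span_basisFun_dense hξ, fun φ => ?_⟩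
  rw [mem_dualD_iff_countable hξ hη h2]
  have : {x ∈ range (basisFun 𝕜 ξ) | φ x ≠ 0} =
      basisFun 𝕜 ξ '' {α | φ (basisFun 𝕜 ξ α) ≠ 0} := by
    ext x
    constructor
    · rintro ⟨⟨α, rfl⟩, h⟩
      exact ⟨α, h, rfl⟩
    · rintro ⟨α, h, rfl⟩
      exact ⟨⟨α, rfl⟩, h⟩
  rw [this]
  exact ⟨fun h => h.image _, fun h => Set.countable_of_injective_of_countable_image
    (basisFun_injective hξ).injOn h⟩

end CountableSupport

/-! ### The commutative projectional skeleton -/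

section Skeleton

variable {𝕜 : Type} [RCLike 𝕜] {η : Ordinal.{u}} {ξ : Iso (kap η) ≃ Iso η}

theorem exists_mem_range_proj (hξ : ξ (isoZero (kap η)) = isoZero η)
    (hη : Ordinal.omega0 ≤ η) (h2 : η < Ordinal.omega 2) (f : C(Seg η, 𝕜)) :
    ∃ β ≤ kap η, β.card ≤ ℵ₀ ∧ f ∈ range (proj 𝕜 hξ β) := by
  have hf : f ∈ closure (⋃ α < kap η, range (proj 𝕜 hξ α)) := by
    rw [← range_proj_limit (kap_isSuccLimit hη), proj_kap]
    exact ⟨f, rfl⟩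
  obtain ⟨g, hg, hlim⟩ := mem_closure_iff_seq_limit.1 hf
  have hex : ∀ n, ∃ α < kap η, g n ∈ range (proj 𝕜 hξ α) := fun n => by
    simpa only [mem_iUnion, exists_prop] using hg n
  choose α hα hgα using hex
  -- Passing to `α_n + 1` gives isolated ordinals, to which the countable bound applies.
  let B : Set (Iso (kap η)) := range fun n =>
    ⟨Order.succ (α n), Order.succ_le_of_lt (hα n), Order.not_isSuccLimit_succ _⟩
  obtain ⟨β, hβκ, hβ, hb⟩ := exists_countable_bound hη h2 (countable_range _ : B.Countable)
  refine ⟨β, hβκ, hβ, (isClosed_range_proj β).mem_of_tendsto hlim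
    (Eventually.of_forall fun n => ?_)⟩
  exact range_proj_mono ((Order.le_succ _).trans (hb _ ⟨n, rfl⟩)) (hgα n)

theorem isProjectionalSkeleton_proj (hξ : ξ (isoZero (kap η)) = isoZero η)
    (hη : Ordinal.omega0 ≤ η) (h2 : η < Ordinal.omega 2) :
    IsProjectionalSkeleton (𝕜 := 𝕜)
      fun s : {α : Ordinal.{u} // α ≤ kap η ∧ α.card ≤ ℵ₀} => proj 𝕜 hξ s.1 := by
  refine ⟨fun s t => ⟨max s t, le_max_left _ _, le_max_right _ _⟩, fun s => ?_,
    fun s t h => proj_mul h, fun σ hσ => ?_, ?_⟩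
  · have hc := (densChar_range_proj_le (𝕜 := 𝕜) hξ s.2.1).trans
      (max_le le_rfl (lift_le_aleph0.2 s.2.2))
    have hne : {c | ∃ t : Set C(Seg η, 𝕜), t ⊆ range (proj 𝕜 hξ s.1) ∧
        range (proj 𝕜 hξ s.1) ⊆ closure t ∧ #t = c}.Nonempty :=
      ⟨_, _, subset_rfl, subset_closure, rfl⟩
    obtain ⟨t, -, ht, htc⟩ := csInf_mem hne
    refine ⟨t, ?_, ht⟩
    rw [← le_aleph0_iff_set_countable, htc]
    exact hc
  · have hbdd : BddAbove (range fun n => (σ n).1) := ⟨kap η, by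
      rintro _ ⟨n, rfl⟩
      exact (σ n).2.1⟩
    let s : {α : Ordinal.{u} // α ≤ kap η ∧ α.card ≤ ℵ₀} := ⟨sSup (range fun n => (σ n).1), by
      refine ⟨csSup_le' ?_, card_sSup_le_aleph0 (countable_range _) ?_⟩
      · rintro _ ⟨n, rfl⟩
        exact (σ n).2.1
      · rintro _ ⟨n, rfl⟩
        exact (σ n).2.2⟩
    have hle : ∀ n, (σ n).1 ≤ s.1 := fun n => le_csSup hbdd ⟨n, rfl⟩
    refine ⟨s, ⟨?_, fun t ht => ?_⟩, Subset.antisymm ?_ ?_⟩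
    · rintro _ ⟨n, rfl⟩
      exact hle n
    · refine (csSup_le' ?_ : s.1 ≤ t.1)
      rintro _ ⟨n, rfl⟩
      exact ht ⟨n, rfl⟩
    -- Either the supremum is attained, or it is a limit ordinal and continuity of the resolution at
    -- limits applies.
    · by_cases h : ∃ n, (σ n).1 = s.1
      · obtain ⟨n, hn⟩ := h
        rw [← hn]
        exact (subset_iUnion (fun n => range (proj 𝕜 hξ (σ n).1)) n).trans subset_closure
      · push Not at h
        have hlt : ∀ n, (σ n).1 < s.1 := fun n => lt_of_le_of_ne (hle n) (h n)
        have hlim : Order.IsSuccLimit s.1 := by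
          rcases Ordinal.zero_or_succ_or_isSuccLimit s.1 with h0 | ⟨t, ht⟩ | hl
          · exact absurd (h0 ▸ hlt 0) not_lt_zero
          · have : s.1 ≤ t := by
              refine csSup_le' ?_
              rintro _ ⟨n, rfl⟩
              have := hlt n
              rw [← ht] at this
              exact Order.lt_succ_iff.1 this
            rw [← ht] at this
            exact absurd (Order.lt_succ t) this.not_gt
          · exact hl
        rw [range_proj_limit hlim]
        refine closure_mono (iUnion₂_subset fun α hα => ?_)
        obtain ⟨_, ⟨n, rfl⟩, hn⟩ := exists_lt_of_lt_csSup (range_nonempty _) hα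
        exact (range_proj_mono hn.le).trans
          (subset_iUnion (fun n => range (proj 𝕜 hξ (σ n).1)) n)
    · exact closure_minimal (iUnion_subset fun n => range_proj_mono (hle n)) (isClosed_range_proj _)
  · refine Set.eq_univ_of_forall fun f => ?_
    obtain ⟨β, h1, h3, h4⟩ := exists_mem_range_proj hξ hη h2 f
    exact mem_iUnion.2 ⟨⟨β, h1, h3⟩, h4⟩

theorem inducedBy_proj (hξ : ξ (isoZero (kap η)) = isoZero η)
    (hη : Ordinal.omega0 ≤ η) (h2 : η < Ordinal.omega 2) :
    InducedBy (dualD 𝕜 η)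
      fun s : {α : Ordinal.{u} // α ≤ kap η ∧ α.card ≤ ℵ₀} => proj 𝕜 hξ s.1 := by
  intro φ
  constructor
  · intro h
    obtain ⟨β, h1, h3, h4⟩ := comp_proj_of_countable hξ hη h2
      ((mem_dualD_iff_countable hξ hη h2 φ).1 h)
    exact ⟨⟨β, h1, h3⟩, φ, h4⟩
  · rintro ⟨s, ψ, rfl⟩
    rw [mem_dualD_iff_countable hξ hη h2]
    exact countable_of_comp_proj hξ s.2.2 ψ

end Skeleton

end OrdinalSegment

namespace OrdinalSegment

/-! ### The topology `σ(C, D)` and the accumulation points of `H` -/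

section Sigma

variable {𝕜 : Type} [RCLike 𝕜] {η : Ordinal.{u}} {ξ : Iso (kap η) ≃ Iso η}

theorem dirac_mem_dualD {x : Seg η} (hx : ¬ ℵ₀ < (x : Ordinal.{u}).cof) :
    dirac x ∈ dualD 𝕜 η := by
  classical
  refine ⟨fun y => if y = x then 1 else 0, ?_, fun y hy => if_neg ?_, fun f => ?_⟩
  · refine summable_of_ne_finset_zero (s := {x}) fun y hy => ?_
    have : y ≠ x := by simpa using hy
    simp [this]
  · rintro rfl
    exact hx hy
  · have : (fun y => (if y = x then (1 : 𝕜) else 0) * f y) = fun y => if y = x then f x else 0 := by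
      ext y
      split_ifs with h
      · rw [h, one_mul]
      · rw [zero_mul]
    rw [this]
    exact hasSum_ite_eq x (f x)

theorem not_aleph0_lt_cof_iso (y : Iso η) : ¬ ℵ₀ < (y : Ordinal.{u}).cof := fun h =>
  y.2.2 (isSuccLimit_of_aleph0_lt_cof h)

theorem isOpen_eval_ne {x : Seg η} (hx : ¬ ℵ₀ < (x : Ordinal.{u}).cof) (c : 𝕜) :
    IsOpen[sigmaTop (dualD 𝕜 η)] {f : C(Seg η, 𝕜) | f x ≠ c} :=
  @IsOpen.preimage _ _ (sigmaTop (dualD 𝕜 η)) _ _ (continuous_sigmaTop (dirac_mem_dualD hx)) {c}ᶜ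
    isOpen_compl_singleton

/-- The topology is a variable because the instance on `C([0, η])` is the norm topology, while the
use is for `σ(C, D)`. -/
theorem mem_closure_of_forall_mem {X ι : Type*} {t : TopologicalSpace X} {T : Set X} {g : X}
    {l : Filter ι} [l.NeBot] {F : ι → X} (h : Tendsto F l (@nhds _ t g)) (hF : ∀ i, F i ∈ T) :
    g ∈ closure[t] T :=
  mem_closure_of_tendsto h (Eventually.of_forall hF)

theorem isOpen_inter_of_top {X : Type*} {t : TopologicalSpace X} {U V : Set X}
    (hU : IsOpen[t] U) (hV : IsOpen[t] V) : IsOpen[t] (U ∩ V) := hU.inter hV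

/-- If `T` contains, for each countable set `N` of points of countable cofinality, a function that
agrees with `g` on `N`, then `g` is in the `σ(C, D)`-closure of `T`. -/
theorem mem_closure_sigmaTop {T : Set C(Seg η, 𝕜)} {g : C(Seg η, 𝕜)}
    (h : ∀ N : Set (Seg η), N.Countable → (∀ x ∈ N, ¬ ℵ₀ < (x : Ordinal.{u}).cof) →
      ∃ f ∈ T, ∀ x ∈ N, f x = g x) : g ∈ closure[sigmaTop (dualD 𝕜 η)] T := by
  let J := {N : Set (Seg η) // N.Countable ∧ ∀ x ∈ N, ¬ ℵ₀ < (x : Ordinal.{u}).cof}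
  have hdir : IsDirectedOrder J := ⟨fun N M => ⟨⟨N.1 ∪ M.1, N.2.1.union M.2.1, fun x hx =>
    hx.elim (N.2.2 x) (M.2.2 x)⟩, subset_union_left, subset_union_right⟩⟩
  have hne : Nonempty J := ⟨⟨∅, countable_empty, fun x hx => absurd hx (notMem_empty x)⟩⟩
  have hex : ∀ N : J, ∃ f ∈ T, ∀ x ∈ N.1, f x = g x := fun N => h N.1 N.2.1 N.2.2
  choose F hFT hF using hex
  -- Along the net of countable sets, each `φ ∈ D` is eventually constant: once the set contains the
  -- support of the measure, `φ (F M) = φ g`.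
  have hlim : Tendsto F atTop (@nhds _ (sigmaTop (dualD 𝕜 η)) g) := by
    simp only [nhds_iInf, tendsto_iInf]
    rintro φ ⟨c, hc, hc0, hsum⟩
    rw [nhds_induced, tendsto_comap_iff]
    have hN : (Function.support c).Countable := by
      simpa [Function.support] using hc.countable_support
    let N : J := ⟨Function.support c, hN, fun x hx hx' => hx (hc0 x hx')⟩
    refine tendsto_const_nhds.congr' ?_
    filter_upwards [eventually_ge_atTop N] with M hM
    have h1 := hsum (F M)
    have h2 : (fun x => c x * F M x) = fun x => c x * g x := by
      ext x
      by_cases hx : c x = 0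
      · rw [hx, zero_mul, zero_mul]
      · rw [hF M x (hM hx)]
    rw [h2] at h1
    exact (hsum g).unique h1
  exact mem_closure_of_forall_mem hlim hFT

theorem exists_mem_inter_of_mem_closure {X : Type*} {t : TopologicalSpace X} {T U : Set X} {g : X}
    (hg : g ∈ closure[t] T) (hU : IsOpen[t] U) (hgU : g ∈ U) : ∃ f ∈ T, f ∈ U := by
  obtain ⟨f, h1, h2⟩ := mem_closure_iff.1 hg U hU hgU
  exact ⟨f, h2, h1⟩

theorem accPt_principal_iff_mem_closure {X : Type*} {t : TopologicalSpace X} {T : Set X} {g : X} :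
    AccPt g (𝓟 T) ↔ g ∈ closure (T \ {g}) := by
  rw [accPt_principal_iff_clusterPt, mem_closure_iff_clusterPt]

/-- A closed subset of `[0, η]` containing all isolated points is everything. -/
theorem mem_of_iso_mem {s : Set (Seg η)} (hs : IsClosed s)
    (h : ∀ y : Iso η, (⟨y, y.2.1⟩ : Seg η) ∈ s) (x : Seg η) : x ∈ s := by
  by_cases hl : Order.IsSuccLimit (x : Ordinal.{u})
  · by_contra hx
    obtain ⟨a, ha, hab⟩ := exists_Ioc_subset_of_mem_nhds (hs.isOpen_compl.mem_nhds hx)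
      ⟨⟨0, Set.mem_Iic.2 zero_le⟩, Subtype.mk_lt_mk.2 hl.bot_lt⟩
    have hlt : (a : Ordinal.{u}) < x := ha
    refine @hab ⟨(isoSucc (hlt.trans_le x.2) : Iso η), (isoSucc (hlt.trans_le x.2)).2.1⟩ ⟨?_, ?_⟩
      (h (isoSucc (hlt.trans_le x.2)))
    · exact Subtype.coe_lt_coe.1 (lt_add_one (a : Ordinal.{u}))
    · exact Subtype.coe_le_coe.1 (Order.add_one_le_of_lt hlt)
  · exact h ⟨x, x.2, hl⟩

theorem eq_of_iso_eq {f g : C(Seg η, 𝕜)}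
    (h : ∀ y : Iso η, f ⟨y, y.2.1⟩ = g ⟨y, y.2.1⟩) : f = g :=
  ContinuousMap.ext fun x => mem_of_iso_mem (isClosed_eq f.continuous g.continuous) h x

/-- A continuous function with values `0` and `1` is locally constant. -/
theorem exists_Ioc_eq {f : C(Seg η, 𝕜)} (hf : ∀ x, f x = 0 ∨ f x = 1) {a : Seg η}
    (ha : (a : Ordinal.{u}) ≠ 0) :
    ∃ b < (a : Ordinal.{u}), ∀ x : Seg η, b < x → x ≤ a → f x = f a := by
  have hn : {x | f x ≠ 1 - f a} ∈ 𝓝 a := by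
    refine (isOpen_ne_fun f.continuous continuous_const).mem_nhds ?_
    rcases hf a with h | h <;> simp [h]
  obtain ⟨b, hb, hab⟩ := exists_Ioc_subset_of_mem_nhds hn
    ⟨⟨0, Set.mem_Iic.2 zero_le⟩, Subtype.mk_lt_mk.2 (pos_iff_ne_zero.2 ha)⟩
  refine ⟨b, hb, fun x hx hxa => ?_⟩
  have h1 : f x ≠ 1 - f a := hab ⟨hx, hxa⟩
  rcases hf x with h | h <;> rcases hf a with h' | h' <;> simp [h, h'] at h1 ⊢

end Sigma

/-! ### The ordinal `θ` and the order of records -/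

section Theta

variable {η : Ordinal.{u}} {ξ : Iso (kap η) ≃ Iso η}

/-- For a limit ordinal `a`, the number `θ` is the least `γ` such that `a ∈ A_γ`. -/
theorem lt_theta_iff {a γ : Ordinal.{u}} (haη : a ≤ η) (ha : Order.IsSuccLimit a) :
    γ < theta ξ a ↔ a ∉ setA ξ γ := by
  have hev : ∀ c : Ordinal.{u}, (∀ᶠ x : Iso η in comap Subtype.val (𝓝[<] a),
      c ≤ ((ξ.symm x : Iso (kap η)) : Ordinal.{u})) ↔
      ∃ b < a, ∀ x : Iso η, b < x → (x : Ordinal.{u}) < a → c ≤ (ξ.symm x : Iso (kap η)) := by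
    intro c
    rw [eventually_comap]
    constructor
    · intro h
      obtain ⟨b, hb, hsub⟩ := (mem_nhdsLT_iff_exists_Ioo_subset' ha.bot_lt).1 h
      exact ⟨b, hb, fun x h1 h2 => hsub ⟨h1, h2⟩ x rfl⟩
    · rintro ⟨b, hb, h⟩
      filter_upwards [Ioo_mem_nhdsLT hb] with y hy x hx
      subst hx
      exact h x hy.1 hy.2
  rw [theta, liminf_eq]
  constructor
  · intro h hmem
    have hne : {c : Ordinal.{u} | ∀ᶠ x : Iso η in comap Subtype.val (𝓝[<] a),
      c ≤ ((ξ.symm x : Iso (kap η)) : Ordinal.{u})}.Nonempty :=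
      ⟨0, (Eventually.of_forall fun _ => zero_le : ∀ᶠ x : Iso η in comap Subtype.val (𝓝[<] a),
        0 ≤ ((ξ.symm x : Iso (kap η)) : Ordinal.{u}))⟩
    obtain ⟨c, hc, hγc⟩ := exists_lt_of_lt_csSup hne h
    obtain ⟨b, hb, hb'⟩ := (hev c).1 hc
    obtain ⟨β, h1, h2, h3⟩ := exists_xi_of_mem_setA hmem hb
    have := hb' (ξ β) h2 (lt_of_le_of_ne h3 fun e => (ξ β).2.2 (by rw [e]; exact ha))
    rw [Equiv.symm_apply_apply] at this
    exact (hγc.trans_le (this.trans h1)).false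
  · intro h
    have hb : ∃ b < a, ∀ β : Iso (kap η), (β : Ordinal.{u}) ≤ γ → b < ξ β →
        ¬ (ξ β : Ordinal.{u}) ≤ a := by
      by_contra! hcon
      exact h (mem_setA_of_forall ha.bot_lt.ne' hcon)
    obtain ⟨b, hb, hb'⟩ := hb
    -- No `ξ(β)` with `β ≤ γ` lies in `(b, a]`, so `γ + 1` is an eventual lower bound. Eventual
    -- lower bounds are at most `κ`, as every left neighbourhood of `a` contains isolated points.
    refine (Order.lt_succ γ).trans_le (le_csSup ⟨kap η, fun c hc => ?_⟩ ((hev _).2 ⟨b, hb, ?_⟩))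
    · obtain ⟨b, hb, hb'⟩ := (hev c).1 hc
      exact (hb' (isoSucc (hb.trans_le haη)) (lt_add_one b) (ha.add_one_lt hb)).trans (ξ.symm _).2.1
    · intro x h1 h2
      refine Order.succ_le_of_lt (not_le.1 fun h3 => ?_)
      have := hb' (ξ.symm x) h3
      rw [Equiv.apply_symm_apply] at this
      exact this h1 h2.le

theorem theta_le_iff {a γ : Ordinal.{u}} (haη : a ≤ η) (ha : Order.IsSuccLimit a) :
    theta ξ a ≤ γ ↔ a ∈ setA ξ γ := by
  rw [← not_lt, lt_theta_iff haη ha, not_not]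

theorem theta_pos (hξ : ξ (isoZero (kap η)) = isoZero η) {a : Ordinal.{u}} (haη : a ≤ η)
    (ha : Order.IsSuccLimit a) : 0 < theta ξ a := by
  rw [lt_theta_iff haη ha]
  intro h
  obtain ⟨β, h1, h2, -⟩ := exists_xi_of_mem_setA h ha.bot_lt
  exact h2.ne' ((xi_eq_zero_iff hξ).2 (le_antisymm h1 zero_le))

/-- The first point `ξ(γ)` that falls into `(b, a]` is a record. -/
theorem exists_isRecord {a b : Ordinal.{u}} (haη : a ≤ η) (ha : Order.IsSuccLimit a) (hb : b < a) :
    ∃ γ : Iso (kap η), (γ : Ordinal.{u}) ≤ theta ξ a ∧ b < ξ γ ∧ (ξ γ : Ordinal.{u}) < a ∧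
      IsRecord ξ γ a ∧ ∀ β : Iso (kap η), (β : Ordinal.{u}) < γ → (ξ β : Ordinal.{u}) ≤ a →
        (ξ β : Ordinal.{u}) ≤ b := by
  obtain ⟨β, h1, h2, h3⟩ := exists_xi_of_mem_setA ((theta_le_iff (ξ := ξ) haη ha).1 le_rfl) hb
  -- The least index with value in `(b, a]`; one exists below `θ + 1` because `a ∈ A_θ`.
  obtain ⟨γ, ⟨h4, h5⟩, hmin⟩ := WellFounded.has_min (wellFounded_lt (α := Iso (kap η)))
    {γ | b < ξ γ ∧ (ξ γ : Ordinal.{u}) ≤ a} ⟨β, h2, h3⟩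
  have hγ : ∀ β : Iso (kap η), (β : Ordinal.{u}) < γ → (ξ β : Ordinal.{u}) ≤ a →
      (ξ β : Ordinal.{u}) ≤ b := fun β h h' => not_lt.1 fun h'' => hmin β ⟨h'', h'⟩ h
  exact ⟨γ, (not_lt.1 (hmin β ⟨h2, h3⟩) : (γ : Ordinal.{u}) ≤ β).trans h1, h4,
    lt_of_le_of_ne h5 fun e => (ξ γ).2.2 (by rw [e]; exact ha),
    ⟨h5, fun β h h' => (hγ β h h').trans_lt h4⟩, hγ⟩

theorem IsRecord.le_of_xi {β γ : Iso (kap η)} (h : IsRecord ξ β (ξ γ)) :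
    (β : Ordinal.{u}) ≤ γ :=
  not_lt.1 fun hlt => (h.2 γ hlt le_rfl).not_ge h.1

/-- With `IsRecord.of_le` and `IsRecord.le_of_xi`: if `γ` is a record at `x`, the records at `ξ(γ)`
are exactly the records at `x` of index at most `γ`. -/
theorem IsRecord.trans {β γ : Iso (kap η)} {x : Ordinal.{u}} (h : IsRecord ξ β (ξ γ))
    (h' : IsRecord ξ γ x) : IsRecord ξ β x :=
  ⟨h.1.trans h'.1, fun β' hβ' hx => h.2 β' hβ' (h'.2 β' (hβ'.trans_le h.le_of_xi) hx).le⟩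

theorem IsRecord.of_le {β γ : Iso (kap η)} {x : Ordinal.{u}} (h : IsRecord ξ β x)
    (h' : IsRecord ξ γ x) (hle : (β : Ordinal.{u}) ≤ γ) : IsRecord ξ β (ξ γ) := by
  refine ⟨?_, fun β' hβ' hx => h.2 β' hβ' (hx.trans h'.1)⟩
  rcases hle.lt_or_eq with hlt | heq
  · exact (h'.2 β hlt h.1).le
  · rw [Subtype.ext heq]

theorem IsRecord.xi_lt {β γ : Iso (kap η)} {x : Ordinal.{u}} (h : IsRecord ξ β x)
    (h' : IsRecord ξ γ x) (hlt : (γ : Ordinal.{u}) < β) : (ξ γ : Ordinal.{u}) < ξ β :=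
  h.2 γ hlt h'.1

end Theta

/-! ### Accumulation points of `H` -/

section Accumulation

variable {𝕜 : Type} [RCLike 𝕜] {η : Ordinal.{u}} {ξ : Iso (kap η) ≃ Iso η}

/-- Given countable `N`, some `f_α` must vanish on it. If `η` has uncountable cofinality, `N` is
bounded by some `b < η` and `ξ(α) = b + 1` works; if `κ` has, then `N ⊆ A_b` for some `b < κ` and `α
= b + 1` works. -/
theorem zero_accPt (hξ : ξ (isoZero (kap η)) = isoZero η)
    (h : ℵ₀ < η.cof ∨ ℵ₀ < (kap η).cof) :
    @AccPt _ (sigmaTop (dualD 𝕜 η)) 0 (𝓟 (setH 𝕜 ξ)) := by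
  rw [accPt_principal_iff_mem_closure]
  refine mem_closure_sigmaTop fun N hN hNc => ?_
  suffices hs : ∃ α : Iso (kap η), ∀ x ∈ N, basisFun 𝕜 ξ α x = 0 by
    obtain ⟨α, hα⟩ := hs
    exact ⟨_, ⟨Or.inl ⟨α, rfl⟩, basisFun_ne_zero hξ α⟩, hα⟩
  rcases h with h | h
  · obtain ⟨b, hb, hb'⟩ := exists_bound_of_countable h (hN.image Subtype.val) (by
      rintro _ ⟨x, hx, rfl⟩
      exact lt_of_le_of_ne x.2 fun e => hNc x hx (by rw [e]; exact h))
    refine ⟨ξ.symm (isoSucc hb), fun x hx => (basisFun_apply_eq_zero hξ).2 fun hr => ?_⟩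
    have h1 := hr.1
    rw [Equiv.apply_symm_apply] at h1
    exact ((lt_add_one b).trans_le h1).not_ge (hb' _ ⟨x, hx, rfl⟩)
  · have hex : ∀ x : N, ∃ B : Set (Iso (kap η)), B.Countable ∧
        ∀ α : Ordinal.{u}, (∀ β ∈ B, (β : Ordinal.{u}) ≤ α) →
          ((x : Seg η) : Ordinal.{u}) ∈ setA ξ α :=
      fun x => exists_countable_mem_setA x.1.2 (hNc x x.2)
    choose B hBc hB using hex
    have := hN.to_subtype
    obtain ⟨b, hb, hb'⟩ := exists_bound_of_countable h
      ((countable_iUnion hBc).image Subtype.val) (by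
        rintro _ ⟨β, -, rfl⟩
        exact lt_of_le_of_ne β.2.1 fun e => β.2.2 (by
          rw [e]; exact isSuccLimit_of_aleph0_lt_cof h))
    refine ⟨isoSucc hb, fun x hx => basisFun_apply_of_mem_setA hξ (β := b) (lt_add_one b) ?_⟩
    exact hB ⟨x, hx⟩ b fun β hβ => hb' _ ⟨β, mem_iUnion.2 ⟨⟨x, hx⟩, hβ⟩, rfl⟩

theorem accPt_of_mem_accSet (hξ : ξ (isoZero (kap η)) = isoZero η) {g : C(Seg η, 𝕜)}
    (hg : g ∈ accSet 𝕜 ξ) :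
    g ≠ 0 ∧ @AccPt _ (sigmaTop (dualD 𝕜 η)) g (𝓟 (setH 𝕜 ξ)) := by
  classical
  obtain ⟨a, ha, d, hcof, hθ, ⟨⟨γ, hγ, hd⟩, hmin⟩, rfl⟩ := hg
  have hl := isSuccLimit_of_aleph0_lt_cof hcof
  have hz : ∀ δ < theta ξ a, ∀ y, a ≤ y → y ≤ η → (y ≤ zMax ξ a δ ↔
      ∀ β : Iso (kap η), (β : Ordinal.{u}) ≤ δ → a ≤ ξ β → y < ξ β) := fun δ hδ y h1 h2 =>
    le_zMax_iff ha.le hl.bot_lt.ne' ((lt_theta_iff ha.le hl).1 hδ) h1 h2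
  have hxi : ∀ β : Iso (kap η), (ξ β : Ordinal.{u}) ≠ a := fun β e =>
    (ξ β).2.2 (by rw [e]; exact hl)
  constructor
  · intro h
    -- The index of `a + 1` exceeds `θ`, so `a + 1` is not met before stage `θ` and the interval is
    -- nonempty.
    have h1 : (a + 1 : Ordinal.{u}) ≤ d := by
      rw [hd, hz γ hγ _ (lt_add_one a).le (Order.add_one_le_of_lt ha)]
      intro β hβ haβ
      refine lt_of_le_of_ne (Order.add_one_le_of_lt (lt_of_le_of_ne haβ (hxi β).symm)) fun e => ?_
      have : ξ.symm (isoSucc ha) = β := by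
        rw [Equiv.symm_apply_eq]
        exact Subtype.ext e
      rw [this] at hθ
      exact (hθ.trans_le hβ).not_ge hγ.le
    have h2 := congrArg (fun f : C(Seg η, 𝕜) => f ⟨a + 1, Order.add_one_le_of_lt ha⟩) h
    simp only [chi_apply, ContinuousMap.zero_apply] at h2
    rw [if_pos ⟨le_rfl, h1⟩] at h2
    exact one_ne_zero h2
  · rw [accPt_principal_iff_mem_closure]
    refine mem_closure_sigmaTop fun N hN hNc => ?_
    obtain ⟨b, hb, hb'⟩ := exists_bound_of_countable hcof
      (((hN.image Subtype.val).mono inter_subset_left :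
        (Subtype.val '' N ∩ {y | y < a}).Countable)) fun y hy => hy.2
    have hb0 : ∃ b < a, ∀ β : Iso (kap η), (β : Ordinal.{u}) ≤ γ → b < ξ β →
        ¬ (ξ β : Ordinal.{u}) ≤ a := by
      by_contra! hcon
      exact (lt_theta_iff ha.le hl).1 hγ (mem_setA_of_forall hl.bot_lt.ne' hcon)
    obtain ⟨b0, hb0, hb0'⟩ := hb0
    -- Being beyond `b` makes `f_α` vanish on the part of `N` below `a`; being beyond `b0` forces `α
    -- > γ`, so that points of index at most `γ` cut `f_α` off after `d`.
    obtain ⟨α, hαθ, hbα, hαa, hrec, hfirst⟩ := exists_isRecord (ξ := ξ) ha.le hl (max_lt hb hb0)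
    have hγα : γ < α := not_le.1 fun h => hb0' α h ((le_max_right _ _).trans_lt hbα) hαa.le
    have hα0 : (α : Ordinal.{u}) ≠ 0 := ne_bot_of_gt hγα
    -- Possibly `α = θ`; the minimality of `d` is therefore applied to `α - 1`.
    have hpα : prd α < theta ξ a := ((le_prd_iff hα0).1 le_rfl).trans_le hαθ
    refine ⟨basisFun 𝕜 ξ α, ⟨Or.inl ⟨α, rfl⟩, fun h => ?_⟩, fun x hx => ?_⟩
    · have h1 := basisFun_pt (𝕜 := 𝕜) hξ α
      rw [Set.mem_singleton_iff.1 h, chi_apply, if_neg] at h1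
      · exact zero_ne_one h1
      · exact fun h2 => (hαa.trans (lt_add_one a)).not_ge h2.1
    · rw [basisFun_apply hξ, chi_apply]
      have key : IsRecord ξ α x ↔
          (((isoSucc ha : Iso η) : Ordinal.{u}) ≤ x ∧ (x : Ordinal.{u}) ≤ d) := by
        rcases lt_trichotomy (x : Ordinal.{u}) a with hxa | hxa | hxa
        · refine iff_of_false (fun h => ?_) fun h => (hxa.trans (lt_add_one a)).not_ge h.1
          exact (hb' _ ⟨⟨x, hx, rfl⟩, hxa⟩).not_gt (((le_max_left _ _).trans_lt hbα).trans_le h.1)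
        · exact absurd (by rw [hxa]; exact hcof) (hNc x hx)
        · refine Iff.trans ⟨fun h => ?_, fun h => ?_⟩
            (and_iff_right (Order.add_one_le_of_lt hxa)).symm
          · rw [hd, hz γ hγ x hxa.le x.2]
            intro β hβ haβ
            refine not_le.1 fun hβx => ?_
            exact ((h.2 β (hβ.trans_lt hγα) hβx).trans hαa).not_ge haβ
          · refine ⟨hαa.le.trans hxa.le, fun β hβ hβx => ?_⟩
            have hdz := h.trans (hmin ⟨prd α, hpα, rfl⟩)
            rw [hz _ hpα x hxa.le x.2] at hdz
            have hβa : (ξ β : Ordinal.{u}) < a := not_le.1 fun h' =>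
              (hdz β ((le_prd_iff hα0).2 hβ) h').not_ge hβx
            exact hrec.2 β hβ hβa.le
      simp only [key]

/-- The values of a function in the closure of `H`. -/
theorem eq_zero_or_one_of_mem_closure (hξ : ξ (isoZero (kap η)) = isoZero η) {g : C(Seg η, 𝕜)}
    (hg : g ∈ closure[sigmaTop (dualD 𝕜 η)] (setH 𝕜 ξ)) (x : Seg η) : g x = 0 ∨ g x = 1 := by
  classical
  refine mem_of_iso_mem (s := {x | g x = 0 ∨ g x = 1}) ?_ (fun y => ?_) x
  · exact (isClosed_eq g.continuous continuous_const).union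
      (isClosed_eq g.continuous continuous_const)
  · by_contra hcon
    have hcon' : g ⟨y, y.2.1⟩ ≠ 0 ∧ g ⟨y, y.2.1⟩ ≠ 1 := not_or.1 hcon
    obtain ⟨f, hf, h0, h1⟩ := exists_mem_inter_of_mem_closure hg
      (isOpen_inter_of_top (isOpen_eval_ne (not_aleph0_lt_cof_iso y) (0 : 𝕜))
        (isOpen_eval_ne (x := ⟨y, y.2.1⟩) (not_aleph0_lt_cof_iso y) (1 : 𝕜))) hcon'
    rcases hf with ⟨α, rfl⟩ | hf
    · rw [Set.mem_ofPred_eq, basisFun_apply hξ] at h0 h1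
      split_ifs at h0 h1
      · exact h1 rfl
      · exact h0 rfl
    · rw [Set.mem_singleton_iff.1 hf] at h0
      exact h0 rfl

theorem exists_eval_ne {f g : C(Seg η, 𝕜)} (h : f ≠ g) :
    ∃ y : Iso η, f ⟨y, y.2.1⟩ ≠ g ⟨y, y.2.1⟩ := by
  by_contra! hcon
  exact h (eq_of_iso_eq hcon)

/-- An accumulation point of `H` has an open neighbourhood avoiding a given `f_α`. -/
theorem exists_isOpen_avoiding {g : C(Seg η, 𝕜)} (α : Iso (kap η)) :
    ∃ U, IsOpen[sigmaTop (dualD 𝕜 η)] U ∧ g ∈ U ∧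
      ∀ f ∈ setH 𝕜 ξ \ {g}, f ∈ U → f ≠ basisFun 𝕜 ξ α := by
  by_cases h : g = basisFun 𝕜 ξ α
  · exact ⟨Set.univ, @isOpen_univ _ (sigmaTop _), mem_univ _, fun f hf _ e => hf.2 (e.trans h.symm)⟩
  · obtain ⟨y, hy⟩ := exists_eval_ne h
    exact ⟨_, isOpen_eval_ne (not_aleph0_lt_cof_iso y) _, hy, fun f _ hf e => hf (e ▸ rfl)⟩

/-- Otherwise `{μ_α ≠ 0}` is a neighbourhood of `g` meeting `H` only in `f_α`, and `f_α` itself can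
be avoided. -/
theorem basisMeas_eq_zero_of_accPt (hξ : ξ (isoZero (kap η)) = isoZero η) {g : C(Seg η, 𝕜)}
    (hg : g ∈ closure[sigmaTop (dualD 𝕜 η)] (setH 𝕜 ξ \ {g})) {α : Iso (kap η)}
    (hα : basisMeas 𝕜 ξ α ∈ dualD 𝕜 η) : basisMeas 𝕜 ξ α g = 0 := by
  by_contra hne
  obtain ⟨U, hU, hgU, hUα⟩ := exists_isOpen_avoiding (ξ := ξ) (g := g) α
  obtain ⟨hV, hVH⟩ := exists_isOpen_inter_setH hξ hα
  obtain ⟨f, hf, hfU, hfV⟩ := exists_mem_inter_of_mem_closure hg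
    (isOpen_inter_of_top hU hV) ⟨hgU, hne⟩
  have : f ∈ ({basisFun 𝕜 ξ α} : Set C(Seg η, 𝕜)) := hVH ▸ ⟨hfV, hf.1⟩
  exact hUα f hf hfU this

/-- A coordinate with `μ_α(g) ≠ 0` has `μ_α ∉ D`, so its point `p` has uncountable cofinality and
plays the role of `a`. Since `g(p) ≠ g(ξ(α))`, either `g(p) = 1`, which transitivity of records
excludes, or `g` is approximated by `f_β` with `β ≤ θ` a record at `p` and both `β` and `ξ(β)`
arbitrarily late. -/
theorem mem_accSet_of_accPt (hξ : ξ (isoZero (kap η)) = isoZero η) {g : C(Seg η, 𝕜)}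
    (hg0 : g ≠ 0) (hg : g ∈ closure[sigmaTop (dualD 𝕜 η)] (setH 𝕜 ξ \ {g})) :
    g ∈ accSet 𝕜 ξ := by
  classical
  have hgH : g ∈ closure[sigmaTop (dualD 𝕜 η)] (setH 𝕜 ξ) :=
    @closure_mono _ (sigmaTop _) _ _ sdiff_subset _ hg
  have h01 := eq_zero_or_one_of_mem_closure hξ hgH
  obtain ⟨α, hα⟩ : ∃ α, basisMeas 𝕜 ξ α g ≠ 0 := by
    by_contra! hcon
    exact hg0 (eq_of_basisMeas_eq hξ fun α => by rw [hcon, map_zero])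
  have hαD : basisMeas 𝕜 ξ α ∉ dualD 𝕜 η := fun h => hα (basisMeas_eq_zero_of_accPt hξ hg h)
  have hα0 : (α : Ordinal.{u}) ≠ 0 := by
    intro h0
    refine hαD ?_
    rw [basisMeas, if_pos h0]
    exact dirac_mem_dualD (by simp)
  set p : Seg η := retr (setA ξ (prd α)) (pt ξ α) with hp
  have hpA : (p : Ordinal.{u}) ∈ setA ξ (prd α) := (retr_isGreatest hξ _ _).1.2
  have hcof : ℵ₀ < (p : Ordinal.{u}).cof := by
    by_contra hcon
    refine hαD ?_
    rw [basisMeas, if_neg hα0, pMax_eq_retr (xi_notMem_setA_prd hξ hα0)]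
    exact Submodule.sub_mem _ (dirac_mem_dualD (not_aleph0_lt_cof_iso (ξ α))) (dirac_mem_dualD hcon)
  have hl := isSuccLimit_of_aleph0_lt_cof hcof
  have hpξ : (p : Ordinal.{u}) < ξ α :=
    lt_of_le_of_ne (retr_le _ _) fun e => (ξ α).2.2 (by rw [← e]; exact hl)
  have hpη : (p : Ordinal.{u}) < η := hpξ.trans_le (ξ α).2.1
  have hθα : theta ξ p ≤ prd α := (theta_le_iff hpη.le hl).2 hpA
  -- Otherwise `p + 1 ≤ ξ(α)` would belong to `A_{α-1}`, against the maximality of `p`.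
  have hθ : theta ξ p < (ξ.symm (isoSucc hpη) : Iso (kap η)) := by
    by_contra! hcon
    have := xi_le_retr hξ (x := pt ξ α) (hcon.trans hθα)
      (by rw [Equiv.apply_symm_apply]; exact Order.add_one_le_of_lt hpξ)
    rw [Equiv.apply_symm_apply] at this
    exact (lt_add_one (p : Ordinal.{u})).not_ge this
  have hrecp : ∀ β : Iso (kap η), (β : Ordinal.{u}) < α → (IsRecord ξ β p ↔ IsRecord ξ β (ξ α)) :=
    fun β hβ => isRecord_retr_iff hξ (x := pt ξ α) ((le_prd_iff hα0).2 hβ)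
  have hlt : ∀ β : Iso (kap η), (β : Ordinal.{u}) ≤ theta ξ p → (β : Ordinal.{u}) < α :=
    fun β hβ => (le_prd_iff hα0).1 (hβ.trans hθα)
  obtain ⟨b, hb, hbg⟩ := exists_Ioc_eq h01 hl.bot_lt.ne'
  rw [basisMeas_apply hξ g hα0, ← hp, sub_ne_zero] at hα
  rcases h01 p with hgp | hgp
  swap
  · have hgα : g (pt ξ α) = 0 := (h01 _).resolve_right fun h => hα (h.trans hgp.symm)
    -- Any `f_β` nonzero at `ξ(γ)` has `β` a record at `ξ(γ)`, hence at `p`, hence at `ξ(α)`; so no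
    -- element of `H` is close to `g` at both points.
    obtain ⟨γ, hγθ, hbγ, hγp, hrec, -⟩ := exists_isRecord (ξ := ξ) hpη.le hl hb
    have hgγ : g (pt ξ γ) = 1 := (hbg (pt ξ γ) hbγ hγp.le).trans hgp
    obtain ⟨f, hf, hf1, hf2⟩ := exists_mem_inter_of_mem_closure hg
      (isOpen_inter_of_top
        (isOpen_eval_ne (x := pt ξ γ) (not_aleph0_lt_cof_iso (ξ γ)) (0 : 𝕜))
        (isOpen_eval_ne (x := pt ξ α) (not_aleph0_lt_cof_iso (ξ α)) (1 : 𝕜)))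
      ⟨by rw [Set.mem_ofPred_eq, hgγ]; exact one_ne_zero,
        by rw [Set.mem_ofPred_eq, hgα]; exact zero_ne_one⟩
    rcases hf.1 with ⟨β, rfl⟩ | h
    · have h1 : IsRecord ξ β (ξ γ) := by
        by_contra h
        exact hf1 ((basisFun_apply_eq_zero hξ).2 h)
      refine absurd ((basisFun_apply_eq_one hξ).2 ?_) hf2
      exact (hrecp β (h1.le_of_xi.trans_lt (hlt γ hγθ))).1 (h1.trans hrec)
    · rw [Set.mem_singleton_iff.1 h] at hf1
      exact absurd rfl hf1
  have hgα : g (pt ξ α) = 1 := (h01 _).resolve_left fun h => hα (h.trans hgp.symm)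
  -- `g` is approximated by functions `f_β` with `ξ(β)` a late record below `p`
  have happ : ∀ c < (p : Ordinal.{u}), ∀ γ < theta ξ p, ∀ U, IsOpen[sigmaTop (dualD 𝕜 η)] U →
      g ∈ U → ∃ β : Iso (kap η), basisFun 𝕜 ξ β ∈ U ∧ IsRecord ξ β p ∧ c < ξ β ∧
        γ < β ∧ (β : Ordinal.{u}) ≤ theta ξ p := by
    intro c hc γ hγ U hU hgU
    have hb0 : ∃ b < (p : Ordinal.{u}), ∀ β : Iso (kap η), (β : Ordinal.{u}) ≤ γ → b < ξ β →
        ¬ (ξ β : Ordinal.{u}) ≤ p := by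
      by_contra! hcon
      exact (lt_theta_iff hpη.le hl).1 hγ (mem_setA_of_forall hl.bot_lt.ne' hcon)
    obtain ⟨b0, hb0, hb0'⟩ := hb0
    obtain ⟨δ, hδθ, hbδ, hδp, hrec, -⟩ :=
      exists_isRecord (ξ := ξ) hpη.le hl (max_lt (max_lt hb hb0) hc)
    have hcδ := (le_max_right _ _).trans_lt hbδ
    have hbδ' := ((le_max_left _ _).trans (le_max_left _ _)).trans_lt hbδ
    have hb0δ := ((le_max_right _ _).trans (le_max_left _ _)).trans_lt hbδ
    have hγδ : γ < δ := not_le.1 fun h => hb0' δ h hb0δ hδp.le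
    have hgδ : g (pt ξ δ) = 0 := (hbg (pt ξ δ) hbδ' hδp.le).trans hgp
    obtain ⟨V, hV, hgV, hVα⟩ := exists_isOpen_avoiding (ξ := ξ) (g := g) α
    obtain ⟨f, hf, ⟨⟨hf1, hf2⟩, hfV⟩, hfU⟩ := exists_mem_inter_of_mem_closure hg
      (isOpen_inter_of_top (isOpen_inter_of_top
        (isOpen_inter_of_top
          (isOpen_eval_ne (x := pt ξ δ) (not_aleph0_lt_cof_iso (ξ δ)) (1 : 𝕜))
          (isOpen_eval_ne (x := pt ξ α) (not_aleph0_lt_cof_iso (ξ α)) (0 : 𝕜))) hV) hU)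
      ⟨⟨⟨by rw [Set.mem_ofPred_eq, hgδ]; exact zero_ne_one,
        by rw [Set.mem_ofPred_eq, hgα]; exact one_ne_zero⟩, hgV⟩, hgU⟩
    rcases hf.1 with ⟨β, rfl⟩ | h
    · have h1 : IsRecord ξ β (ξ α) := by
        by_contra h
        exact hf2 ((basisFun_apply_eq_zero hξ).2 h)
      have hne : β ≠ α := fun e => hVα _ hf hfV (e ▸ rfl)
      have hβα : (β : Ordinal.{u}) < α := lt_of_le_of_ne h1.le_of_xi fun e => hne (Subtype.ext e)
      have h2 := (hrecp β hβα).2 h1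
      -- Both are records at `p`, so `β ≤ δ` would make `β` a record at `ξ(δ)`, where `f_β ≠ 1`.
      have h3 : (δ : Ordinal.{u}) < β := by
        by_contra! h
        exact hf1 ((basisFun_apply_eq_one hξ).2 (h2.of_le hrec h))
      refine ⟨β, hfU, h2, hcδ.trans (h2.xi_lt hrec h3), hγδ.trans h3, ?_⟩
      by_contra! h
      -- `p ∈ A_θ`, so indices beyond `θ` are not records at `p`.
      have h4 := basisFun_apply_of_mem_setA (𝕜 := 𝕜) hξ h (x := p)
        ((theta_le_iff hpη.le hl).1 le_rfl)
      exact (basisFun_apply_eq_zero hξ).1 h4 h2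
    · rw [Set.mem_singleton_iff.1 h] at hf2
      exact absurd rfl hf2
  have hθ0 := theta_pos hξ hpη.le hl
  have hne : {y | ∃ γ < theta ξ p, y = zMax ξ p γ}.Nonempty := ⟨_, 0, hθ0, rfl⟩
  obtain ⟨γ0, hγ0, hd⟩ := csInf_mem hne
  set d := sInf {y | ∃ γ < theta ξ p, y = zMax ξ p γ} with hd'
  have hmin : ∀ γ < theta ξ p, d ≤ zMax ξ p γ := fun γ hγ => csInf_le' ⟨γ, hγ, rfl⟩
  have hz : ∀ δ < theta ξ p, ∀ y, (p : Ordinal.{u}) ≤ y → y ≤ η → (y ≤ zMax ξ p δ ↔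
      ∀ β : Iso (kap η), (β : Ordinal.{u}) ≤ δ → (p : Ordinal.{u}) ≤ ξ β → y < ξ β) :=
    fun δ hδ y h1 h2 =>
      le_zMax_iff hpη.le hl.bot_lt.ne' ((lt_theta_iff hpη.le hl).1 hδ) h1 h2
  refine ⟨p, hpη, d, hcof, hθ, ⟨⟨γ0, hγ0, hd⟩, ?_⟩, eq_of_iso_eq fun y => ?_⟩
  · rintro _ ⟨γ, hγ, rfl⟩
    exact hmin γ hγ
  have hyp : (y : Ordinal.{u}) ≠ p := fun e => y.2.2 (by rw [e]; exact hl)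
  rw [chi_apply]
  -- Compare at isolated `y`: below `p` take `ξ(β) > y`; in `(p, d]` no index before `β ≤ θ` has its
  -- value in `[p, y]`, so `β` stays a record; beyond `d` an index at most `γ0 < β` destroys it.
  rcases lt_or_gt_of_ne hyp with hyp | hyp
  · rw [if_neg fun h => (hyp.trans (lt_add_one (p : Ordinal.{u}))).not_ge h.1]
    by_contra hgy
    obtain ⟨β, hβ, -, hyβ, -⟩ := happ y hyp 0 hθ0 _
      (isOpen_eval_ne (x := ⟨y, y.2.1⟩) (not_aleph0_lt_cof_iso y) 0) hgy
    exact hβ ((basisFun_apply_eq_zero hξ).2 fun h => hyβ.not_ge h.1)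
  · rcases le_or_gt (y : Ordinal.{u}) d with hyd | hyd
    · rw [if_pos ⟨Order.add_one_le_of_lt hyp, hyd⟩]
      by_contra hgy
      obtain ⟨β, hβ, hrec, -, h0β, hβθ⟩ := happ 0 hl.bot_lt 0 hθ0 _
        (isOpen_eval_ne (x := ⟨y, y.2.1⟩) (not_aleph0_lt_cof_iso y) (1 : 𝕜)) hgy
      have hpβ : prd β < theta ξ p := ((le_prd_iff h0β.ne').1 le_rfl).trans_le hβθ
      refine hβ ((basisFun_apply_eq_one hξ).2 ⟨hrec.1.trans hyp.le, fun β' hβ' hy => ?_⟩)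
      have h1 := hyd.trans (hmin _ hpβ)
      rw [hz _ hpβ y hyp.le y.2.1] at h1
      refine hrec.2 β' hβ' (not_lt.1 fun h => ?_)
      exact (h1 β' ((le_prd_iff h0β.ne').2 hβ') h.le).not_ge hy
    · rw [if_neg fun h => hyd.not_ge h.2]
      by_contra hgy
      obtain ⟨β, hβ, hrec, -, h0β, hβθ⟩ := happ 0 hl.bot_lt γ0 hγ0 _
        (isOpen_eval_ne (x := ⟨y, y.2.1⟩) (not_aleph0_lt_cof_iso y) 0) hgy
      refine hβ ((basisFun_apply_eq_zero hξ).2 fun h => ?_)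
      have h1 := hyd.not_ge
      rw [hd, hz γ0 hγ0 y hyp.le y.2.1] at h1
      push Not at h1
      obtain ⟨β', h2, h3, h4⟩ := h1
      exact ((h.2 β' (h2.trans_lt h0β) h4).trans_le hrec.1).not_ge h3

theorem setOf_accPt_eq (hξ : ξ (isoZero (kap η)) = isoZero η) :
    {g : C(Seg η, 𝕜) | g ≠ 0 ∧ @AccPt _ (sigmaTop (dualD 𝕜 η)) g (𝓟 (setH 𝕜 ξ))} =
      accSet 𝕜 ξ := by
  ext g
  refine ⟨fun h => mem_accSet_of_accPt hξ h.1 (accPt_principal_iff_mem_closure.1 h.2),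
    fun h => accPt_of_mem_accSet hξ h⟩

theorem closure_setH (hξ : ξ (isoZero (kap η)) = isoZero η) :
    closure[sigmaTop (dualD 𝕜 η)] (setH 𝕜 ξ) = setH 𝕜 ξ ∪ accSet 𝕜 ξ := by
  rw [@closure_eq_self_union_derivedSet _ (sigmaTop (dualD 𝕜 η)), ← setOf_accPt_eq hξ]
  ext g
  constructor
  · rintro (h | h)
    · exact Or.inl h
    · by_cases h0 : g = 0
      · exact Or.inl (Or.inr h0)
      · exact Or.inr ⟨h0, h⟩
  · rintro (h | h)
    · exact Or.inl h
    · exact Or.inr h.2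

end Accumulation

end OrdinalSegment

/-! ### Assembly of the proposition -/

theorem propositionP {𝕜 : Type} [RCLike 𝕜] (η : Ordinal.{u}) (hη : Ordinal.omega0 ≤ η)
    (ξ : Iso (kap η) ≃ Iso η) (hξ : ξ (isoZero (kap η)) = isoZero η) :
    -- the maxima defining `r_A`, `z` and `p` exist
    ((∀ α ≤ kap η, ∀ x : Seg η,
        IsGreatest (Set.Iic (x : Ordinal.{u}) ∩ setA ξ α) (retr (setA ξ α) x)) ∧
      ∀ α < kap η, ∀ x : Seg η, (x : Ordinal.{u}) ∉ setA ξ α →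
        IsGreatest (zSet ξ x α) (zMax ξ x α) ∧
          IsGreatest (setA ξ α ∩ Set.Iio (x : Ordinal.{u})) (pMax ξ x α)) ∧
    -- the PRI given by `ξ`, which yields the basis
    (∃ P : Ordinal.{u} → (C(Seg η, 𝕜) →L[𝕜] C(Seg η, 𝕜)),
      (∀ α ≤ kap η, ∀ f x, P α f x = f (retr (setA ξ α) x)) ∧
      IsPRI (kap η) (Function.update P 0 0) ∧
      (∀ α β, α ≤ β → β ≤ kap η → P α * P β = P α ∧ P β * P α = P α) ∧
      (∀ f, P 0 f = basisMeas 𝕜 ξ (isoZero (kap η)) f • basisFun 𝕜 ξ (isoZero (kap η))) ∧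
      ∀ α : Iso (kap η), (α : Ordinal.{u}) ≠ 0 →
        ∀ f, P α f - P (prd α) f = basisMeas 𝕜 ξ α f • basisFun 𝕜 ξ α) ∧
    -- (a)
    IsStrongMarkushevichBasis (basisFun 𝕜 ξ) (basisMeas 𝕜 ξ) ∧
    -- (b)
    (η < Ordinal.omega 2 →
      -- property (6)
      (∀ φ : StrongDual 𝕜 C(Seg η, 𝕜),
        φ ∈ dualD 𝕜 η ↔ {α : Iso (kap η) | φ (basisFun 𝕜 ξ α) ≠ 0}.Countable) ∧
      -- properties (7) and (8)
      WeakStarCountablyClosed (dualD 𝕜 η) ∧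
      (∀ α, basisMeas 𝕜 ξ α ∈ dualD 𝕜 η) ∧
      @IsLindelof _ (sigmaTop (dualD 𝕜 η)) (setH 𝕜 ξ) ∧
      @IsPrimarilyLindelof _ (sigmaTop (dualD 𝕜 η)) (setH 𝕜 ξ) ∧
      -- closedness, and isolatedness of the nonzero points
      IsClosed[sigmaTop (dualD 𝕜 η)] (setH 𝕜 ξ) ∧
      (∀ h ∈ setH 𝕜 ξ, h ≠ 0 →
        ∃ U, IsOpen[sigmaTop (dualD 𝕜 η)] U ∧ U ∩ setH 𝕜 ξ = {h}) ∧
      -- the `Σ`-subspace and a commutative skeleton compatible with the basis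
      IsSigmaSubspaceOf (dualD 𝕜 η) (Set.range (basisFun 𝕜 ξ)) ∧
      ∃ (Γ : Type (u + 1)) (_ : PartialOrder Γ)
        (Q : Γ → (C(Seg η, 𝕜) →L[𝕜] C(Seg η, 𝕜))),
        IsProjectionalSkeleton Q ∧ (∀ s t, Q s * Q t = Q t * Q s) ∧ InducedBy (dualD 𝕜 η) Q ∧
        ∀ s α, (basisFun 𝕜 ξ α ∈ Set.range (Q s) → Q s (basisFun 𝕜 ξ α) = basisFun 𝕜 ξ α) ∧
          (basisFun 𝕜 ξ α ∉ Set.range (Q s) → Q s (basisFun 𝕜 ξ α) = 0)) ∧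
    -- (c-i)
    ((ℵ₀ < η.cof ∨ ℵ₀ < (kap η).cof) →
      @AccPt _ (sigmaTop (dualD 𝕜 η)) 0 (𝓟 (setH 𝕜 ξ))) ∧
    -- (c-ii)
    {g : C(Seg η, 𝕜) | g ≠ 0 ∧ @AccPt _ (sigmaTop (dualD 𝕜 η)) g (𝓟 (setH 𝕜 ξ))} = accSet 𝕜 ξ ∧
    -- (c-iii)
    closure[sigmaTop (dualD 𝕜 η)] (setH 𝕜 ξ) = setH 𝕜 ξ ∪ accSet 𝕜 ξ := by
  refine ⟨⟨fun α _ x => retr_isGreatest hξ α x, fun α _ x hx => ⟨zMax_isGreatest x.2 ?_ hx,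
    pMax_isGreatest hξ hx⟩⟩, ?_, isStrongMarkushevichBasis hξ, fun h2 => ?_, zero_accPt hξ,
    setOf_accPt_eq hξ, closure_setH hξ⟩
  · exact fun h0 => hx (h0 ▸ zero_mem_setA hξ α)
  · refine ⟨proj 𝕜 hξ, fun _ _ _ _ => rfl, ?_, fun _ _ h _ => proj_mul h, proj_zero_apply hξ,
      fun _ h0 f => proj_sub_proj_prd hξ h0 f⟩
    convert isPRI_proj (𝕜 := 𝕜) hξ hη
  · have hD := basisMeas_mem_dualD_of_lt (𝕜 := 𝕜) hξ hη h2
    refine ⟨mem_dualD_iff_countable hξ hη h2, weakStarCountablyClosed_of_countable hξ hη h2, hD,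
      ?_, ?_, ?_, ?_, isSigmaSubspaceOf hξ hη h2, _, inferInstance, _,
      isProjectionalSkeleton_proj hξ hη h2, fun s t => ?_, inducedBy_proj hξ hη h2, ?_⟩
    · rw [← range_lindelofMap]
      exact @isLindelof_range_of_continuous _ (sigmaTop _) _ _ (continuous_lindelofMap hξ hη h2)
    · rw [← range_lindelofMap]
      exact @isPrimarilyLindelof_range _ (sigmaTop _) _ _ (continuous_lindelofMap hξ hη h2)
    · rw [setH_eq hξ]
      exact @isClosed_of_products _ _ _ _ (sigmaTop _) _ fun i => continuous_sigmaTop (hD i)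
    · rintro h (⟨α, rfl⟩ | h0) hne
      · exact ⟨_, exists_isOpen_inter_setH hξ (hD α)⟩
      · exact absurd (Set.mem_singleton_iff.1 h0) hne
    · rcases le_total s.1 t.1 with h | h
      · exact (proj_mul h).1.trans (proj_mul h).2.symm
      · exact (proj_mul h).2.trans (proj_mul h).1.symm
    · refine fun s α => ⟨fun h => mem_range_proj.1 h, fun h => ?_⟩
      rcases le_or_gt (α : Ordinal.{u}) s.1 with hα | hα
      · exact absurd (mem_range_proj.2 (proj_basisFun_of_le hξ hα)) h
      · exact proj_basisFun_of_lt hξ hα
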